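/- Let $\mathbb{K}$ be a commutative unital ring; all algebras (associative, unital, not necessarily commutative), coalgebras and unadorned tensor products are over $\mathbb{K}$. For an algebra $P$ with a right coaction $\rho^C\colon P\to P\otimes C$, $p\mapsto p_{(0)}\otimes p_{(1)}$, of a coalgebra $C$, put $P^{\mathrm{co}\,C}=\{b\in P:\ \rho^C(bp)=b\,\rho^C(p)\text{ for all }p\in P\}$. One says that $P^C(D)$ is a $C$-coalgebra Galois extension if $D= P^{\mathrm{co}\,C}$ and the canonical map $$\mathrm{can}^C_P\colon P\otimes_D P\to P\otimes C,\qquad p\otimes_D p'\mapsto p\,p'_{(0)}\otimes p'_{(1)}$$ is bijective (it is then an isomorphism of left $P$-modules and right $C$-comodules); its translation map is $C\to P\otimes_D P$, $c\mapsto c^{[1]}\otimes_D c^{[2]}=(\mathrm{can}^C_P)^{-1}(1\otimes c)$. For a Hopf algebra $H$, $A^H(B)$ is an $H$-Hopf-Galois extension if it is an $H$-coalgebra Galois extension and the coaction $\rho^H\colon A\to A\otimes H$ is an algebra map. Suppose that: 1. $H$ is a Hopf algebra and $A^H(B)$ is an $H$-Hopf-Galois extension such that $A$ is faithfully flat as a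 right $B$-module and flat as a left $B$-module; 2. $C$ is a coalgebra that is flat as a $\mathbb{K}$-module; 3. $P^C(D)$ is a $C$-coalgebra Galois extension such that $P$ is faithfully flat as a right $D$-module and flat as a left $D$-module; 4. $P$ is an $(H,C)$-bicomodule and a left $H$-comodule algebra, i.e. it carries a left $H$-coaction ${}^H\rho\colon P\to H\otimes P$, $p\mapsto p_{(-1)}\otimes p_{(0)}$, that is an algebra map and commutes with the right $C$-coaction; 5. $D\subseteq{}^{\mathrm{co}\,H}P=\{p\in P:\ {}^H\rho(p)=1\otimes p\}$. Let $A\Box_H P=\{q\in A\otimes P:\ (\rho^H\otimes P)(q)=(A\otimes{}^H\rho)(q)\}$, a subalgebra of $A\otimes P$, with the right $C$-coaction obtained by restricting $A\otimes\rho^C$ (it takes values in $(A\Box_H P)\otimes C\subseteq A\otimes P\otimes C$ because $C$ is flat), and with the algebra map $B\otimes D\to A\Box_H P$, $b\otimes d\mapsto b\otimes d$. Then this map is injective, it identifies $B\otimes D$ with $(A\Box_H P)^{\mathrm{co}\,C}$, and $(A\Box_H P)^C(B\otimes D)$ is a $C$-coalgebra Galois extension; moreover $A\Box_H P$ is faithfully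 flat as a right $B\otimes D$-module. Explicitly, the natural map $(A\Box_H P)\otimes_{B\otimes D}(A\Box_H P)\to(A\otimes P)\otimes_{B\otimes D}(A\otimes P)$ is injective and, identifying its source with its image, the inverse of the canonical map is $$(\mathrm{can}^C_{A\Box_H P})^{-1}\Bigl(\sum_i(a_i\otimes p_i)\otimes c\Bigr)=\sum_i\bigl(a_i\,c^{[2]}{}_{(-1)}{}^{[1]}\otimes p_i\,c^{[1]}\bigr)\otimes_{B\otimes D}\bigl(c^{[2]}{}_{(-1)}{}^{[2]}\otimes c^{[2]}{}_{(0)}\bigr)$$ for all $\sum_i a_i\otimes p_i\in A\Box_H P$ and $c\in C$, where $c^{[1]}\otimes_D c^{[2]}$ denotes the translation map of $P^C(D)$ and $h^{[1]}\otimes_B h^{[2]}$, for $h\in H$, that of $A^H(B)$. -/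

import Mathlib

open scoped TensorProduct

universe u

noncomputable section

namespace CotensorGalois

/-! ### Tensor products over a noncommutative algebra -/

section Balanced

variable {K : Type u} [CommRing K] {R : Type u} [Ring R] [Algebra K R]

/-- The relations `m r ⊗ n - m ⊗ r n`, for a right action `α` of `R` on `M` and a left action `β`
of `R` on `N`. -/
def balRel {M N : Type u} [AddCommGroup M] [Module K M] [AddCommGroup N] [Module K N]
    (α : M →ₗ[K] R →ₗ[K] M) (β : R →ₗ[K] N →ₗ[K] N) : Submodule K (M ⊗[K] N) :=
  Submodule.span K {x | ∃ (m : M) (r : R) (n : N), x = (α m r) ⊗ₜ[K] n - m ⊗ₜ[K] (β r n)}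

/-- The tensor product `M ⊗_R N` of a right `R`-module `M` (with action `α`) and a left `R`-module
`N` (with action `β`), over a not necessarily commutative `K`-algebra `R`. -/
abbrev BalTensor {M N : Type u} [AddCommGroup M] [Module K M] [AddCommGroup N] [Module K N]
    (α : M →ₗ[K] R →ₗ[K] M) (β : R →ₗ[K] N →ₗ[K] N) : Type u :=
  (M ⊗[K] N) ⧸ balRel α β

variable {M N M' N' V : Type u} [AddCommGroup M] [Module K M] [AddCommGroup N] [Module K N]
  [AddCommGroup M'] [Module K M'] [AddCommGroup N'] [Module K N'] [AddCommGroup V] [Module K V]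

/-- The class `m ⊗_R n`, bilinear in `m` and `n`. -/
def BalTensor.mk (α : M →ₗ[K] R →ₗ[K] M) (β : R →ₗ[K] N →ₗ[K] N) :
    M →ₗ[K] N →ₗ[K] BalTensor α β :=
  (TensorProduct.mk K M N).compr₂ (balRel α β).mkQ

/-- A `K`-linear map on `M ⊗[K] N` that respects the relations descends to `M ⊗_R N`. -/
def BalTensor.lift (α : M →ₗ[K] R →ₗ[K] M) (β : R →ₗ[K] N →ₗ[K] N) (f : M ⊗[K] N →ₗ[K] V)
    (hf : ∀ m r n, f ((α m r) ⊗ₜ[K] n) = f (m ⊗ₜ[K] (β r n))) : BalTensor α β →ₗ[K] V :=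
  (balRel α β).liftQ f (by
    rw [balRel, Submodule.span_le]
    rintro x ⟨m, r, n, rfl⟩
    simp [hf])

theorem BalTensor.mk_balanced (α : M →ₗ[K] R →ₗ[K] M) (β : R →ₗ[K] N →ₗ[K] N) (m : M) (r : R)
    (n : N) : BalTensor.mk α β (α m r) n = BalTensor.mk α β m (β r n) := by
  refine (Submodule.Quotient.eq _).2 (Submodule.subset_span ⟨m, r, n, rfl⟩)

@[simp] theorem BalTensor.lift_mk (α : M →ₗ[K] R →ₗ[K] M) (β : R →ₗ[K] N →ₗ[K] N)
    (f : M ⊗[K] N →ₗ[K] V) (hf : ∀ m r n, f ((α m r) ⊗ₜ[K] n) = f (m ⊗ₜ[K] (β r n)))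
    (m : M) (n : N) : BalTensor.lift α β f hf (BalTensor.mk α β m n) = f (m ⊗ₜ[K] n) := rfl

/-- The map `m ⊗_R n ↦ f m ⊗_R g n` for `R`-linear maps `f` and `g`. -/
def BalTensor.map {α : M →ₗ[K] R →ₗ[K] M} {β : R →ₗ[K] N →ₗ[K] N} {α' : M' →ₗ[K] R →ₗ[K] M'}
    {β' : R →ₗ[K] N' →ₗ[K] N'} (f : M →ₗ[K] M') (g : N →ₗ[K] N')
    (hf : ∀ m r, f (α m r) = α' (f m) r) (hg : ∀ r n, g (β r n) = β' r (g n)) :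
    BalTensor α β →ₗ[K] BalTensor α' β' :=
  BalTensor.lift α β ((balRel α' β').mkQ ∘ₗ TensorProduct.map f g) (by
    intro m r n
    have h := BalTensor.mk_balanced α' β' (f m) r (g n)
    rw [← hf, ← hg] at h
    exact h)

@[simp] theorem BalTensor.map_mk {α : M →ₗ[K] R →ₗ[K] M} {β : R →ₗ[K] N →ₗ[K] N}
    {α' : M' →ₗ[K] R →ₗ[K] M'} {β' : R →ₗ[K] N' →ₗ[K] N'} (f : M →ₗ[K] M') (g : N →ₗ[K] N')
    (hf : ∀ m r, f (α m r) = α' (f m) r) (hg : ∀ r n, g (β r n) = β' r (g n)) (m : M) (n : N) :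
    BalTensor.map f g hf hg (BalTensor.mk α β m n) = BalTensor.mk α' β' (f m) (g n) := rfl

/-- The left action of `R` on a left `R`-module `N`. -/
def leftModAct (K : Type u) [CommRing K] (R : Type u) [Ring R] [Algebra K R] (N : Type u)
    [AddCommGroup N] [Module K N] [Module R N] [IsScalarTower K R N] : R →ₗ[K] N →ₗ[K] N :=
  (Algebra.lsmul K K N).toLinearMap

/-- The right action of `R` on a right `R`-module `N`, that is, a module over `Rᵐᵒᵖ`. -/
def rightModAct (K : Type u) [CommRing K] (R : Type u) [Ring R] [Algebra K R] (N : Type u)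
    [AddCommGroup N] [Module K N] [Module Rᵐᵒᵖ N] [IsScalarTower K Rᵐᵒᵖ N] :
    N →ₗ[K] R →ₗ[K] N :=
  ((Algebra.lsmul K K N).toLinearMap ∘ₗ (MulOpposite.opLinearEquiv K).toLinearMap).flip

theorem leftModAct_apply (N : Type u) [AddCommGroup N] [Module K N] [Module R N]
    [IsScalarTower K R N] (r : R) (n : N) : leftModAct K R N r n = r • n := rfl

theorem rightModAct_apply (N : Type u) [AddCommGroup N] [Module K N] [Module Rᵐᵒᵖ N]
    [IsScalarTower K Rᵐᵒᵖ N] (r : R) (n : N) :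
    rightModAct K R N n r = MulOpposite.op r • n := rfl

end Balanced

/-! ### Algebra extensions, flatness -/

section Extension

variable {K : Type u} [CommRing K] {R S : Type u} [Ring R] [Algebra K R] [Ring S] [Algebra K S]

/-- `S` as a right `R`-module through `f : R → S`: `(s, r) ↦ s * f r`. -/
def rightAct (f : R →ₐ[K] S) : S →ₗ[K] R →ₗ[K] S := (LinearMap.mul K S).compl₂ f.toLinearMap

/-- `S` as a left `R`-module through `f : R → S`: `(r, s) ↦ f r * s`. -/
def leftAct (f : R →ₐ[K] S) : R →ₗ[K] S →ₗ[K] S := (LinearMap.mul K S) ∘ₗ f.toLinearMap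

@[simp] theorem rightAct_apply (f : R →ₐ[K] S) (s : S) (r : R) : rightAct f s r = s * f r := rfl

@[simp] theorem leftAct_apply (f : R →ₐ[K] S) (r : R) (s : S) : leftAct f r s = f r * s := rfl

/-- `S ⊗_R S` for an algebra map `f : R → S`. -/
abbrev ExtTensor (f : R →ₐ[K] S) : Type u := BalTensor (rightAct f) (leftAct f)

/-- `S ⊗_R g : S ⊗_R N → S ⊗_R N'` for a map `g : N → N'` of left `R`-modules. -/
def extLTensor (f : R →ₐ[K] S) {N N' : Type u} [AddCommGroup N] [Module K N] [Module R N]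
    [IsScalarTower K R N] [AddCommGroup N'] [Module K N'] [Module R N'] [IsScalarTower K R N']
    (g : N →ₗ[R] N') :
    BalTensor (rightAct f) (leftModAct K R N) →ₗ[K] BalTensor (rightAct f) (leftModAct K R N') :=
  BalTensor.map LinearMap.id (g.restrictScalars K) (fun _ _ => rfl)
    (fun r n => by simp [leftModAct_apply])

/-- `g ⊗_R S : N ⊗_R S → N' ⊗_R S` for a map `g : N → N'` of right `R`-modules. -/
def extRTensor (f : R →ₐ[K] S) {N N' : Type u} [AddCommGroup N] [Module K N] [Module Rᵐᵒᵖ N]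
    [IsScalarTower K Rᵐᵒᵖ N] [AddCommGroup N'] [Module K N'] [Module Rᵐᵒᵖ N']
    [IsScalarTower K Rᵐᵒᵖ N'] (g : N →ₗ[Rᵐᵒᵖ] N') :
    BalTensor (rightModAct K R N) (leftAct f) →ₗ[K] BalTensor (rightModAct K R N') (leftAct f) :=
  BalTensor.map (g.restrictScalars K) LinearMap.id
    (fun n r => by simp [rightModAct_apply]) (fun _ _ => rfl)

/-- `S` is faithfully flat as a right `R`-module: a sequence of left `R`-modules is exact if and
only if it is exact after applying `S ⊗_R -`. -/
def IsRightFaithfullyFlat (f : R →ₐ[K] S) : Prop :=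
  ∀ (N N' N'' : Type u) [AddCommGroup N] [AddCommGroup N'] [AddCommGroup N'']
    [Module K N] [Module K N'] [Module K N''] [Module R N] [Module R N'] [Module R N'']
    [IsScalarTower K R N] [IsScalarTower K R N'] [IsScalarTower K R N'']
    (g : N →ₗ[R] N') (g' : N' →ₗ[R] N''),
    Function.Exact (extLTensor f g) (extLTensor f g') ↔ Function.Exact g g'

/-- `S` is flat as a left `R`-module: `- ⊗_R S` preserves exact sequences of right `R`-modules. -/
def IsLeftFlat (f : R →ₐ[K] S) : Prop :=
  ∀ (N N' N'' : Type u) [AddCommGroup N] [AddCommGroup N'] [AddCommGroup N'']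
    [Module K N] [Module K N'] [Module K N''] [Module Rᵐᵒᵖ N] [Module Rᵐᵒᵖ N'] [Module Rᵐᵒᵖ N'']
    [IsScalarTower K Rᵐᵒᵖ N] [IsScalarTower K Rᵐᵒᵖ N'] [IsScalarTower K Rᵐᵒᵖ N'']
    (g : N →ₗ[Rᵐᵒᵖ] N') (g' : N' →ₗ[Rᵐᵒᵖ] N''),
    Function.Exact g g' → Function.Exact (extRTensor f g) (extRTensor f g')

end Extension

/-! ### Comodules, coinvariants and coalgebra Galois extensions -/

section Comodule

variable {K : Type u} [CommRing K] {C : Type u} [AddCommGroup C] [Module K C]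

section Axioms

variable [Coalgebra K C]

/-- `ρ` is a coassociative and counital right `C`-coaction. -/
structure IsRightCoaction {M : Type u} [AddCommGroup M] [Module K M]
    (ρ : M →ₗ[K] M ⊗[K] C) : Prop where
  coassoc : (TensorProduct.assoc K M C C).toLinearMap ∘ₗ ρ.rTensor C ∘ₗ ρ =
    (Coalgebra.comul (R := K) (A := C)).lTensor M ∘ₗ ρ
  counit : (TensorProduct.rid K M).toLinearMap ∘ₗ
    (Coalgebra.counit (R := K) (A := C)).lTensor M ∘ₗ ρ = LinearMap.id

/-- `l` is a coassociative and counital left `C`-coaction. -/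
structure IsLeftCoaction {M : Type u} [AddCommGroup M] [Module K M]
    (l : M →ₗ[K] C ⊗[K] M) : Prop where
  coassoc : l.lTensor C ∘ₗ l = (TensorProduct.assoc K C C M).toLinearMap ∘ₗ
    (Coalgebra.comul (R := K) (A := C)).rTensor M ∘ₗ l
  counit : (TensorProduct.lid K M).toLinearMap ∘ₗ
    (Coalgebra.counit (R := K) (A := C)).rTensor M ∘ₗ l = LinearMap.id

end Axioms

/-- The left `H`-coaction `l` and the right `C`-coaction `ρ` on `M` commute. -/
def IsBicomodule {H : Type u} [AddCommGroup H] [Module K H] {M : Type u} [AddCommGroup M]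
    [Module K M] (l : M →ₗ[K] H ⊗[K] M) (ρ : M →ₗ[K] M ⊗[K] C) : Prop :=
  (TensorProduct.assoc K H M C).toLinearMap ∘ₗ l.rTensor C ∘ₗ ρ = ρ.lTensor H ∘ₗ l

variable {B P : Type u} [Ring B] [Algebra K B] [Ring P] [Algebra K P]

/-- Left multiplication on the first factor of `P ⊗ C`: `(p, p' ⊗ c) ↦ p p' ⊗ c`. -/
def mulFst (C : Type u) [AddCommGroup C] [Module K C] (p : P) : P ⊗[K] C →ₗ[K] P ⊗[K] C :=
  (LinearMap.mulLeft K p).rTensor C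

@[simp] theorem mulFst_tmul (p p' : P) (c : C) :
    mulFst C p (p' ⊗ₜ[K] c) = (p * p') ⊗ₜ[K] c := rfl

theorem mulFst_mul (p p' : P) (x : P ⊗[K] C) :
    mulFst C (p * p') x = mulFst C p (mulFst C p' x) := by
  induction x using TensorProduct.induction_on with
  | zero => simp
  | tmul a c => simp [mul_assoc]
  | add x y hx hy => simp [hx, hy]

theorem mulFst_add (p p' : P) (x : P ⊗[K] C) :
    mulFst C (p + p') x = mulFst C p x + mulFst C p' x := by
  induction x using TensorProduct.induction_on with
  | zero => simp
  | tmul a c => simp [add_mul, TensorProduct.add_tmul]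
  | add x y hx hy => simp only [map_add, hx, hy]; abel

theorem mulFst_algebraMap (k : K) (x : P ⊗[K] C) :
    mulFst C (algebraMap K P k) x = k • x := by
  induction x using TensorProduct.induction_on with
  | zero => simp
  | tmul a c => simp [Algebra.smul_def, TensorProduct.smul_tmul']
  | add x y hx hy => simp [hx, hy]

/-- The subalgebra of coinvariants `P^{co C} = {b | ρ(b p) = b ρ(p) for all p}` of an algebra `P`
with a right `C`-coaction `ρ`, which is not assumed to be multiplicative. -/
def coinv (ρ : P →ₗ[K] P ⊗[K] C) : Subalgebra K P where
  carrier := {b | ∀ p, ρ (b * p) = mulFst C b (ρ p)}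
  mul_mem' {a b} ha hb p := by rw [mul_assoc, ha, hb, mulFst_mul]
  add_mem' {a b} ha hb p := by rw [add_mul, map_add, ha, hb, mulFst_add]
  algebraMap_mem' k p := by rw [← Algebra.smul_def, map_smul, mulFst_algebraMap]

theorem mem_coinv {ρ : P →ₗ[K] P ⊗[K] C} {b : P} :
    b ∈ coinv ρ ↔ ∀ p, ρ (b * p) = mulFst C b (ρ p) := Iff.rfl

/-- For a comodule algebra over a bialgebra, the coinvariants are the elements with
`ρ b = b ⊗ 1`. -/
theorem mem_coinv_iff_of_algHom {H : Type u} [Ring H] [Bialgebra K H] (ρ : P →ₐ[K] P ⊗[K] H)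
    {b : P} : b ∈ coinv ρ.toLinearMap ↔ ρ b = b ⊗ₜ[K] 1 := by
  constructor
  · intro h
    simpa [Algebra.TensorProduct.one_def] using h 1
  · intro h p
    have key : ∀ x : P ⊗[K] H, (b ⊗ₜ[K] (1 : H)) * x = mulFst H b x := by
      intro x
      induction x using TensorProduct.induction_on with
      | zero => simp
      | tmul a c => simp
      | add x y hx hy => rw [mul_add, hx, hy, map_add]
    simp [h, key]

/-- The map `P ⊗ P → P ⊗ C`, `p ⊗ p' ↦ p ρ(p')`. -/
def canLift (ρ : P →ₗ[K] P ⊗[K] C) : P ⊗[K] P →ₗ[K] P ⊗[K] C :=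
  (LinearMap.mul' K P).rTensor C ∘ₗ (TensorProduct.assoc K P P C).symm.toLinearMap ∘ₗ
    ρ.lTensor P

theorem canLift_tmul (ρ : P →ₗ[K] P ⊗[K] C) (p p' : P) :
    canLift ρ (p ⊗ₜ[K] p') = mulFst C p (ρ p') := by
  simp only [canLift, LinearMap.comp_apply, LinearMap.lTensor_tmul, LinearEquiv.coe_coe]
  induction ρ p' using TensorProduct.induction_on with
  | zero => simp
  | tmul a c => simp
  | add x y hx hy => simp only [TensorProduct.tmul_add, map_add, hx, hy]

/-- The canonical map `can : P ⊗_B P → P ⊗ C`, `p ⊗_B p' ↦ p p'_(0) ⊗ p'_(1)`. -/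
def can (i : B →ₐ[K] P) (ρ : P →ₗ[K] P ⊗[K] C) (h : i.range ≤ coinv ρ) :
    ExtTensor i →ₗ[K] P ⊗[K] C :=
  BalTensor.lift _ _ (canLift ρ) (fun m r n => by
    have := mem_coinv.1 (h ⟨r, rfl⟩) n
    simp only [canLift_tmul, rightAct_apply, leftAct_apply, mulFst_mul]
    exact congrArg _ this.symm)

theorem can_mul_left (i : B →ₐ[K] P) (ρ : P →ₗ[K] P ⊗[K] C) (h : i.range ≤ coinv ρ)
    (p x y : P) :
    can i ρ h (BalTensor.mk _ _ (p * x) y) = mulFst C p (can i ρ h (BalTensor.mk _ _ x y)) := by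
  simp only [can, BalTensor.lift_mk, canLift_tmul, mulFst_mul]

variable [Coalgebra K C]

/-- `P` is a `C`-coalgebra Galois extension of `B`, where `B` is embedded in `P` by `i`: `P` is a
right `C`-comodule, `i` identifies `B` with the coinvariants, and the canonical map is bijective.
(The canonical map is always left `P`-linear and right `C`-colinear, see `can_mul_left` and
`can_colinear`, so that it is then an isomorphism of left `P`-modules and right
`C`-comodules.) -/
structure IsCoalgebraGalois (i : B →ₐ[K] P) (ρ : P →ₗ[K] P ⊗[K] C) : Prop where
  isRightCoaction : IsRightCoaction ρ
  injective : Function.Injective i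
  range_eq : i.range = coinv ρ
  bijective : Function.Bijective (can i ρ range_eq.le)

/-- `A` is an `H`-Hopf-Galois extension of `B`: an `H`-comodule algebra (the coaction is an algebra
map) which is an `H`-coalgebra Galois extension of `B`. -/
def IsHopfGalois {H : Type u} [Ring H] [HopfAlgebra K H] (i : B →ₐ[K] P)
    (ρ : P →ₐ[K] P ⊗[K] H) : Prop :=
  IsCoalgebraGalois i ρ.toLinearMap

/-- `(can ⊗ C)(x ⊗_B y_(0) ⊗ y_(1)) = (P ⊗ Δ)(can (x ⊗_B y))`. -/
theorem can_colinear (i : B →ₐ[K] P) (ρ : P →ₗ[K] P ⊗[K] C) (hρ : IsRightCoaction ρ)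
    (h : i.range ≤ coinv ρ) (x y : P) :
    TensorProduct.assoc K P C C ((can i ρ h).rTensor C
      ((BalTensor.mk (rightAct i) (leftAct i) x).rTensor C (ρ y))) =
    (Coalgebra.comul (R := K) (A := C)).lTensor P (can i ρ h (BalTensor.mk _ _ x y)) := by
  have e : can i ρ h ∘ₗ BalTensor.mk (rightAct i) (leftAct i) x = mulFst C x ∘ₗ ρ := by
    ext z; simp [can, canLift_tmul]
  have e1 : ∀ z : (P ⊗[K] C) ⊗[K] C, TensorProduct.assoc K P C C ((mulFst C x).rTensor C z) =
      (LinearMap.mulLeft K x).rTensor (C ⊗[K] C) (TensorProduct.assoc K P C C z) := by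
    intro z
    have : (TensorProduct.assoc K P C C).toLinearMap ∘ₗ (mulFst C x).rTensor C =
      (LinearMap.mulLeft K x).rTensor (C ⊗[K] C) ∘ₗ
        (TensorProduct.assoc K P C C).toLinearMap := by
      ext a b c; simp
    exact LinearMap.congr_fun this z
  have e2 : ∀ z : P ⊗[K] C, (Coalgebra.comul (R := K) (A := C)).lTensor P (mulFst C x z) =
      (LinearMap.mulLeft K x).rTensor (C ⊗[K] C)
        ((Coalgebra.comul (R := K) (A := C)).lTensor P z) := by
    intro z
    have : (Coalgebra.comul (R := K) (A := C)).lTensor P ∘ₗ mulFst C x =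
      (LinearMap.mulLeft K x).rTensor (C ⊗[K] C) ∘ₗ
        (Coalgebra.comul (R := K) (A := C)).lTensor P := by
      ext a b; simp
    exact LinearMap.congr_fun this z
  rw [← LinearMap.rTensor_comp_apply, e, LinearMap.rTensor_comp_apply, e1,
    show can i ρ h (BalTensor.mk _ _ x y) = mulFst C x (ρ y) from LinearMap.congr_fun e y, e2]
  exact congrArg _ (LinearMap.congr_fun hρ.coassoc y)

variable {i : B →ₐ[K] P} {ρ : P →ₗ[K] P ⊗[K] C}

/-- The canonical map of a coalgebra Galois extension, as an isomorphism. -/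
def IsCoalgebraGalois.canEquiv (h : IsCoalgebraGalois i ρ) : ExtTensor i ≃ₗ[K] P ⊗[K] C :=
  LinearEquiv.ofBijective (can i ρ h.range_eq.le) h.bijective

/-- The translation map `τ : C → P ⊗_B P`, `τ(c) = can⁻¹(1 ⊗ c)`. -/
def IsCoalgebraGalois.translation (h : IsCoalgebraGalois i ρ) : C →ₗ[K] ExtTensor i :=
  h.canEquiv.symm.toLinearMap ∘ₗ TensorProduct.mk K P C 1

end Comodule

/-! ### The cotensor product -/

section Cotensor

variable {K : Type u} [CommRing K] {H : Type u} [Ring H] [HopfAlgebra K H]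
  {A P : Type u} [Ring A] [Algebra K A] [Ring P] [Algebra K P]

/-- `ρ ⊗ P : A ⊗ P → A ⊗ H ⊗ P`. -/
def cotensorFst (ρ : A →ₐ[K] A ⊗[K] H) (P : Type u) [Ring P] [Algebra K P] :
    A ⊗[K] P →ₐ[K] A ⊗[K] (H ⊗[K] P) :=
  (Algebra.TensorProduct.assoc K K K A H P).toAlgHom.comp
    (Algebra.TensorProduct.map ρ (AlgHom.id K P))

/-- `A ⊗ l : A ⊗ P → A ⊗ H ⊗ P`. -/
def cotensorSnd (A : Type u) [Ring A] [Algebra K A] (l : P →ₐ[K] H ⊗[K] P) :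
    A ⊗[K] P →ₐ[K] A ⊗[K] (H ⊗[K] P) :=
  Algebra.TensorProduct.map (AlgHom.id K A) l

/-- The cotensor product `A □_H P`, the equaliser of `ρ ⊗ P` and `A ⊗ l`, as a subalgebra
of `A ⊗ P`. -/
def cotensor (ρ : A →ₐ[K] A ⊗[K] H) (l : P →ₐ[K] H ⊗[K] P) : Subalgebra K (A ⊗[K] P) :=
  AlgHom.equalizer (cotensorFst ρ P) (cotensorSnd A l)

section Coaction

variable {C : Type u} [AddCommGroup C] [Module K C]

/-- The right `C`-coaction `a ⊗ p ↦ a ⊗ ρ(p)` on `A ⊗ P`. -/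
def tensorCoaction (A : Type u) [Ring A] [Algebra K A] (ρC : P →ₗ[K] P ⊗[K] C) :
    A ⊗[K] P →ₗ[K] (A ⊗[K] P) ⊗[K] C :=
  (TensorProduct.assoc K A P C).symm.toLinearMap ∘ₗ ρC.lTensor A

/-- The inclusion `(A □_H P) ⊗ C → (A ⊗ P) ⊗ C`. -/
def cotensorTensorIncl (ρ : A →ₐ[K] A ⊗[K] H) (l : P →ₐ[K] H ⊗[K] P) (C : Type u)
    [AddCommGroup C] [Module K C] : (cotensor ρ l) ⊗[K] C →ₗ[K] (A ⊗[K] P) ⊗[K] C :=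
  (cotensor ρ l).val.toLinearMap.rTensor C

theorem cotensorTensorIncl_injective [Module.Flat K C] (ρ : A →ₐ[K] A ⊗[K] H)
    (l : P →ₐ[K] H ⊗[K] P) : Function.Injective (cotensorTensorIncl ρ l C) :=
  Module.Flat.rTensor_preserves_injective_linearMap _ Subtype.val_injective

theorem cotensor_exact (ρ : A →ₐ[K] A ⊗[K] H) (l : P →ₐ[K] H ⊗[K] P) :
    Function.Exact (cotensor ρ l).val.toLinearMap
      ((cotensorFst ρ P).toLinearMap - (cotensorSnd A l).toLinearMap) := by
  intro x
  constructor
  · intro hx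
    exact ⟨⟨x, sub_eq_zero.1 hx⟩, rfl⟩
  · rintro ⟨y, rfl⟩
    exact sub_eq_zero.2 y.2

theorem tensorCoaction_mem [Module.Flat K C] (ρ : A →ₐ[K] A ⊗[K] H) (l : P →ₐ[K] H ⊗[K] P)
    (ρC : P →ₗ[K] P ⊗[K] C) (hb : IsBicomodule l.toLinearMap ρC) (q : cotensor ρ l) :
    tensorCoaction A ρC q ∈ LinearMap.range (cotensorTensorIncl ρ l C) := by
  have hex := Module.Flat.rTensor_exact C (cotensor_exact ρ l)
  refine (hex _).1 ?_
  -- `j : A ⊗ (H ⊗ P) → (A ⊗ (H ⊗ P)) ⊗ C` is the coaction on the last factor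
  let j : A ⊗[K] (H ⊗[K] P) →ₗ[K] (A ⊗[K] (H ⊗[K] P)) ⊗[K] C :=
    (TensorProduct.assoc K A (H ⊗[K] P) C).symm.toLinearMap ∘ₗ
      ((TensorProduct.assoc K H P C).symm.toLinearMap ∘ₗ ρC.lTensor H).lTensor A
  have h1 : (cotensorFst ρ P).toLinearMap.rTensor C ∘ₗ tensorCoaction A ρC =
      j ∘ₗ (cotensorFst ρ P).toLinearMap := by
    ext a p
    have c1 : ∀ x : P ⊗[K] C, (cotensorFst ρ P).toLinearMap.rTensor C
        ((TensorProduct.assoc K A P C).symm (a ⊗ₜ[K] x)) =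
        (TensorProduct.assoc K A H P).toLinearMap.rTensor C
          ((TensorProduct.assoc K (A ⊗[K] H) P C).symm (ρ a ⊗ₜ[K] x)) := by
      intro x
      induction x using TensorProduct.induction_on with
      | zero => simp
      | add x y hx hy => simp only [TensorProduct.tmul_add, map_add, hx, hy]
      | tmul p' c => rfl
    have c2 : ∀ z : A ⊗[K] H, j (TensorProduct.assoc K A H P (z ⊗ₜ[K] p)) =
        (TensorProduct.assoc K A H P).toLinearMap.rTensor C
          ((TensorProduct.assoc K (A ⊗[K] H) P C).symm (z ⊗ₜ[K] ρC p)) := by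
      intro z
      induction z using TensorProduct.induction_on with
      | zero => simp
      | add x y hx hy => simp only [TensorProduct.add_tmul, map_add, hx, hy]
      | tmul x h =>
        simp only [j, TensorProduct.assoc_tmul, LinearMap.comp_apply, LinearMap.lTensor_tmul,
          LinearEquiv.coe_coe]
        induction ρC p using TensorProduct.induction_on with
        | zero => simp
        | add x y hx hy => simp only [TensorProduct.tmul_add, map_add, hx, hy]
        | tmul p' c => rfl
    exact (c1 (ρC p)).trans (c2 (ρ a)).symm
  have h2 : (cotensorSnd A l).toLinearMap.rTensor C ∘ₗ tensorCoaction A ρC =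
      j ∘ₗ (cotensorSnd A l).toLinearMap := by
    ext a p
    have c1 : ∀ x : P ⊗[K] C, (cotensorSnd A l).toLinearMap.rTensor C
        ((TensorProduct.assoc K A P C).symm (a ⊗ₜ[K] x)) =
        (TensorProduct.assoc K A (H ⊗[K] P) C).symm
          (a ⊗ₜ[K] (l.toLinearMap.rTensor C x)) := by
      intro x
      induction x using TensorProduct.induction_on with
      | zero => simp
      | add x y hx hy => simp only [TensorProduct.tmul_add, map_add, hx, hy]
      | tmul p' c => rfl
    have c2 : (TensorProduct.assoc K H P C).symm (ρC.lTensor H (l p)) =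
        l.toLinearMap.rTensor C (ρC p) := by
      rw [LinearEquiv.symm_apply_eq]
      exact (LinearMap.congr_fun hb p).symm
    refine (c1 (ρC p)).trans ?_
    rw [← c2]
    rfl
  have e : (cotensorFst ρ P).toLinearMap.rTensor C (tensorCoaction A ρC q) =
      (cotensorSnd A l).toLinearMap.rTensor C (tensorCoaction A ρC q) := by
    have e1 := LinearMap.congr_fun h1 (q : A ⊗[K] P)
    have e2 := LinearMap.congr_fun h2 (q : A ⊗[K] P)
    exact (e1.trans (congrArg j q.2)).trans e2.symm
  rw [LinearMap.rTensor_sub]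
  exact sub_eq_zero.2 e

/-- The right `C`-coaction on `A □_H P`, for `C` flat over `K`: the unique factorisation of the
restriction of `a ⊗ p ↦ a ⊗ ρ(p)` through the injection `(A □_H P) ⊗ C → (A ⊗ P) ⊗ C`. -/
def cotensorCoaction [Module.Flat K C] (ρ : A →ₐ[K] A ⊗[K] H) (l : P →ₐ[K] H ⊗[K] P)
    (ρC : P →ₗ[K] P ⊗[K] C) (hb : IsBicomodule l.toLinearMap ρC) :
    cotensor ρ l →ₗ[K] (cotensor ρ l) ⊗[K] C :=
  (LinearEquiv.ofInjective _ (cotensorTensorIncl_injective ρ l)).symm.toLinearMap ∘ₗ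
    (tensorCoaction A ρC ∘ₗ (cotensor ρ l).val.toLinearMap).codRestrict _
      (tensorCoaction_mem ρ l ρC hb)

theorem cotensorCoaction_spec [Module.Flat K C] (ρ : A →ₐ[K] A ⊗[K] H) (l : P →ₐ[K] H ⊗[K] P)
    (ρC : P →ₗ[K] P ⊗[K] C) (hb : IsBicomodule l.toLinearMap ρC) (q : cotensor ρ l) :
    cotensorTensorIncl ρ l C (cotensorCoaction ρ l ρC hb q) = tensorCoaction A ρC q := by
  have := LinearEquiv.apply_symm_apply
    (LinearEquiv.ofInjective _ (cotensorTensorIncl_injective (C := C) ρ l))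
    ((tensorCoaction A ρC ∘ₗ (cotensor ρ l).val.toLinearMap).codRestrict _
      (tensorCoaction_mem ρ l ρC hb) q)
  exact congrArg Subtype.val this

end Coaction

variable {B D : Type u} [Ring B] [Algebra K B] [Ring D] [Algebra K D]

/-- The algebra map `B ⊗ D → A □_H P`, `b ⊗ d ↦ b ⊗ d`, where `B` consists of right coinvariants
of `A` and `D` of left coinvariants of `P`. -/
def cotensorBase (ρ : A →ₐ[K] A ⊗[K] H) (l : P →ₐ[K] H ⊗[K] P) (i : B →ₐ[K] A) (j : D →ₐ[K] P)
    (hi : i.range ≤ coinv ρ.toLinearMap) (hj : ∀ d, l (j d) = 1 ⊗ₜ[K] j d) :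
    B ⊗[K] D →ₐ[K] cotensor ρ l :=
  (Algebra.TensorProduct.map i j).codRestrict (cotensor ρ l) (by
    intro x
    induction x using TensorProduct.induction_on with
    | zero => simp
    | tmul b d =>
      have hb : ρ (i b) = i b ⊗ₜ[K] 1 := (mem_coinv_iff_of_algHom ρ).1 (hi ⟨b, rfl⟩)
      simp [cotensor, cotensorFst, cotensorSnd, AlgHom.mem_equalizer, hb, hj]
    | add x y hx hy => simpa using (cotensor ρ l).add_mem hx hy)

@[simp] theorem cotensorBase_coe (ρ : A →ₐ[K] A ⊗[K] H) (l : P →ₐ[K] H ⊗[K] P) (i : B →ₐ[K] A)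
    (j : D →ₐ[K] P) (hi : i.range ≤ coinv ρ.toLinearMap) (hj : ∀ d, l (j d) = 1 ⊗ₜ[K] j d)
    (x : B ⊗[K] D) :
    (cotensorBase ρ l i j hi hj x : A ⊗[K] P) = Algebra.TensorProduct.map i j x := rfl

/-- The map `(A □_H P) ⊗_{B ⊗ D} (A □_H P) → (A ⊗ P) ⊗_{B ⊗ D} (A ⊗ P)` induced by the
inclusion. -/
def cotensorExtIncl (ρ : A →ₐ[K] A ⊗[K] H) (l : P →ₐ[K] H ⊗[K] P) (i : B →ₐ[K] A)
    (j : D →ₐ[K] P) (hi : i.range ≤ coinv ρ.toLinearMap) (hj : ∀ d, l (j d) = 1 ⊗ₜ[K] j d) :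
    ExtTensor (cotensorBase ρ l i j hi hj) →ₗ[K] ExtTensor (Algebra.TensorProduct.map i j) :=
  BalTensor.map (cotensor ρ l).val.toLinearMap (cotensor ρ l).val.toLinearMap
    (fun _ _ => rfl) (fun _ _ => rfl)

/-! ### The formula for the inverse of the canonical map -/

/-- The map `(A ⊗_B A) ⊗ (P ⊗ P) → (A ⊗ P) ⊗_{B ⊗ D} (A ⊗ P)`,
`(x ⊗_B y) ⊗ (u ⊗ v) ↦ (x ⊗ u) ⊗_{B ⊗ D} (y ⊗ v)`, in curried form. -/
def shuffleAux (i : B →ₐ[K] A) (j : D →ₐ[K] P) :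
    ExtTensor i →ₗ[K] P ⊗[K] P →ₗ[K] ExtTensor (Algebra.TensorProduct.map i j) :=
  BalTensor.lift (rightAct i) (leftAct i)
    (TensorProduct.curry ((balRel (rightAct (Algebra.TensorProduct.map i j))
      (leftAct (Algebra.TensorProduct.map i j))).mkQ ∘ₗ
        (TensorProduct.tensorTensorTensorComm K A A P P).toLinearMap))
    (by
      intro x b y
      ext u v
      have := BalTensor.mk_balanced (rightAct (Algebra.TensorProduct.map i j))
        (leftAct (Algebra.TensorProduct.map i j)) (x ⊗ₜ[K] u) (b ⊗ₜ[K] 1) (y ⊗ₜ[K] v)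
      simp only [rightAct_apply, leftAct_apply, Algebra.TensorProduct.map_tmul, map_one,
        Algebra.TensorProduct.tmul_mul_tmul, mul_one, one_mul] at this
      exact this)

theorem shuffleAux_mk (i : B →ₐ[K] A) (j : D →ₐ[K] P) (x y : A) (u v : P) :
    shuffleAux i j (BalTensor.mk _ _ x y) (u ⊗ₜ[K] v) =
      BalTensor.mk _ _ (x ⊗ₜ[K] u) (y ⊗ₜ[K] v) := rfl

theorem shuffleAux_balanced (i : B →ₐ[K] A) (j : D →ₐ[K] P) (z : ExtTensor i) (u v : P) (d : D) :
    shuffleAux i j z ((u * j d) ⊗ₜ[K] v) = shuffleAux i j z (u ⊗ₜ[K] (j d * v)) := by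
  obtain ⟨z, rfl⟩ := Submodule.mkQ_surjective _ z
  induction z using TensorProduct.induction_on with
  | zero => rw [map_zero, map_zero]; rfl
  | tmul x y =>
    have := BalTensor.mk_balanced (rightAct (Algebra.TensorProduct.map i j))
      (leftAct (Algebra.TensorProduct.map i j)) (x ⊗ₜ[K] u) (1 ⊗ₜ[K] d) (y ⊗ₜ[K] v)
    simp only [rightAct_apply, leftAct_apply, Algebra.TensorProduct.map_tmul, map_one,
      Algebra.TensorProduct.tmul_mul_tmul, mul_one, one_mul] at this
    exact this
  | add x y hx hy =>
    rw [map_add, map_add, LinearMap.add_apply, LinearMap.add_apply, hx, hy]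

/-- The map `(A ⊗_B A) ⊗ (P ⊗_D P) → (A ⊗ P) ⊗_{B ⊗ D} (A ⊗ P)`,
`(x ⊗_B y) ⊗ (u ⊗_D v) ↦ (x ⊗ u) ⊗_{B ⊗ D} (y ⊗ v)`, in curried form. -/
def shuffle (i : B →ₐ[K] A) (j : D →ₐ[K] P) :
    ExtTensor i →ₗ[K] ExtTensor j →ₗ[K] ExtTensor (Algebra.TensorProduct.map i j) :=
  (BalTensor.lift (rightAct j) (leftAct j) (shuffleAux i j).flip
    (fun u d v => LinearMap.ext fun z => shuffleAux_balanced i j z u v d)).flip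

theorem shuffle_mk (i : B →ₐ[K] A) (j : D →ₐ[K] P) (x y : A) (u v : P) :
    shuffle i j (BalTensor.mk _ _ x y) (BalTensor.mk _ _ u v) =
      BalTensor.mk _ _ (x ⊗ₜ[K] u) (y ⊗ₜ[K] v) := rfl

/-- The map `P ⊗_D P → (A ⊗ P) ⊗_{B ⊗ D} (A ⊗ P)`,
`u ⊗_D v ↦ (v_(-1)^[1] ⊗ u) ⊗_{B ⊗ D} (v_(-1)^[2] ⊗ v_(0))`, where `h^[1] ⊗_B h^[2] = τ(h)` for a
linear map `τ : H → A ⊗_B A`. -/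
def twist (l : P →ₐ[K] H ⊗[K] P) (i : B →ₐ[K] A) (j : D →ₐ[K] P)
    (hj : ∀ d, l (j d) = 1 ⊗ₜ[K] j d) (τ : H →ₗ[K] ExtTensor i) :
    ExtTensor j →ₗ[K] ExtTensor (Algebra.TensorProduct.map i j) :=
  BalTensor.lift (rightAct j) (leftAct j)
    (TensorProduct.lift (shuffle i j) ∘ₗ
      TensorProduct.map τ (balRel (rightAct j) (leftAct j)).mkQ ∘ₗ
      (TensorProduct.leftComm K P H P).toLinearMap ∘ₗ l.toLinearMap.lTensor P)
    (by
      intro u d v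
      simp only [LinearMap.comp_apply, LinearMap.lTensor_tmul, AlgHom.toLinearMap_apply,
        LinearEquiv.coe_coe, rightAct_apply, leftAct_apply, map_mul, hj]
      induction l v using TensorProduct.induction_on with
      | zero => simp
      | add x y hx hy => simp only [TensorProduct.tmul_add, mul_add, map_add, hx, hy]
      | tmul h w =>
        have := BalTensor.mk_balanced (rightAct j) (leftAct j) u d w
        simp only [rightAct_apply, leftAct_apply] at this
        simp only [Algebra.TensorProduct.tmul_mul_tmul, one_mul, TensorProduct.leftComm_tmul,
          TensorProduct.map_tmul, TensorProduct.lift.tmul]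
        exact congrArg _ this)

/-- If `l v = ∑ h_k ⊗ w_k` then `twist (u ⊗_D v) = ∑ shuffle (τ h_k) (u ⊗_D w_k)`. -/
theorem twist_mk (l : P →ₐ[K] H ⊗[K] P) (i : B →ₐ[K] A) (j : D →ₐ[K] P)
    (hj : ∀ d, l (j d) = 1 ⊗ₜ[K] j d) (τ : H →ₗ[K] ExtTensor i) (u v : P) {ι : Type*}
    (s : Finset ι) (h : ι → H) (w : ι → P) (hv : l v = ∑ k ∈ s, h k ⊗ₜ[K] w k) :
    twist l i j hj τ (BalTensor.mk _ _ u v) =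
      ∑ k ∈ s, shuffle i j (τ (h k)) (BalTensor.mk _ _ u (w k)) := by
  simp only [twist, BalTensor.lift_mk, LinearMap.comp_apply, LinearMap.lTensor_tmul,
    AlgHom.toLinearMap_apply, hv, TensorProduct.tmul_sum, map_sum, LinearEquiv.coe_coe,
    TensorProduct.leftComm_tmul, TensorProduct.map_tmul, TensorProduct.lift.tmul]
  rfl

/-- Left multiplication by `s` on the first factor of `S ⊗_R S`. -/
def extMulLeft {R S : Type u} [Ring R] [Algebra K R] [Ring S] [Algebra K S] (f : R →ₐ[K] S)
    (s : S) : ExtTensor f →ₗ[K] ExtTensor f :=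
  BalTensor.map (LinearMap.mulLeft K s) LinearMap.id (fun m r => by simp [mul_assoc])
    (fun _ _ => rfl)

/-- The element `∑ (a c^[2]_(-1)^[1] ⊗ p c^[1]) ⊗_{B ⊗ D} (c^[2]_(-1)^[2] ⊗ c^[2]_(0))` of
`(A ⊗ P) ⊗_{B ⊗ D} (A ⊗ P)`, for `q = ∑ a ⊗ p` in `A ⊗ P` and `c` in `C`. -/
def canInvFormula {C : Type u} [AddCommGroup C] [Module K C] [Coalgebra K C]
    {ρ : A →ₐ[K] A ⊗[K] H} {l : P →ₐ[K] H ⊗[K] P} {ρC : P →ₗ[K] P ⊗[K] C}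
    {i : B →ₐ[K] A} {j : D →ₐ[K] P} (hA : IsHopfGalois i ρ) (hP : IsCoalgebraGalois j ρC)
    (hj : ∀ d, l (j d) = 1 ⊗ₜ[K] j d) (q : A ⊗[K] P) (c : C) :
    ExtTensor (Algebra.TensorProduct.map i j) :=
  extMulLeft _ q (twist l i j hj (IsCoalgebraGalois.translation hA) (hP.translation c))

end Cotensor

end CotensorGalois

end

open CotensorGalois

noncomputable section

namespace CotensorGalois


/-! ### Balanced tensor products: generators and induced actions. -/

section Balanced

variable {K : Type u} [CommRing K] {R : Type u} [Ring R] [Algebra K R]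
  {M N Q M' N' V : Type u} [AddCommGroup M] [Module K M] [AddCommGroup N] [Module K N]
  [AddCommGroup Q] [Module K Q]
  [AddCommGroup M'] [Module K M'] [AddCommGroup N'] [Module K N'] [AddCommGroup V] [Module K V]
  {α : M →ₗ[K] R →ₗ[K] M} {β : R →ₗ[K] N →ₗ[K] N}
  {α' : M' →ₗ[K] R →ₗ[K] M'} {β' : R →ₗ[K] N' →ₗ[K] N'}

/-! The proof is faithfully flat descent along `B → A`. Its pivot is the isomorphism `A ⊗_B (A □_H
P) ≅ A ⊗ P`, `a ⊗_B x ↦ (a ⊗ 1) x` (`cotensorMul_bijective`). Flatness keeps the sequence defining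
`A □_H P` exact after `A ⊗_B -`, and the canonical map of `A` rewrites `A ⊗_B (A ⊗ V)` as `A ⊗ H ⊗
V`. In these coordinates the equaliser becomes that of `A ⊗ Δ ⊗ P` and `A ⊗ H ⊗ l` on `A ⊗ H ⊗ P`,
which is the image of `A ⊗ P` under `A ⊗ l`.

Everything about `S = A □_H P` is then tested after `A ⊗_B -`. For a left `B ⊗ D`-module `N` one
gets `A ⊗_B (S ⊗_{B ⊗ D} N) ≅ (A ⊗ P) ⊗_{B ⊗ D} N ≅ A ⊗_B (P ⊗_D N)`, so faithful flatness of `A`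
over `B` and of `P` over `D` gives that of `S` over `B ⊗ D` (`isRightFaithfullyFlat_cotensorBase`).
For `N = S` the middle term is also `P ⊗_D (A ⊗_B S) ≅ P ⊗_D (A ⊗ P)`, which the canonical map of
`P` identifies with `A ⊗ P ⊗ C`. The composite is the canonical map of `S` tensored with `A`, so the
latter is bijective (`can_cotensor_bijective`).

The coinvariants need no separate computation: a faithfully flat extension with injective canonical
map has its base as algebra of coinvariants (`IsRightFaithfullyFlat.range_eq_coinv`).

For the formula, the right-hand side is extended to a linear map `canInv` on all of `(A ⊗ P) ⊗ C`
and evaluated on canonical images `s ρ(t)` with `s`, `t` in `S`. The defining condition of the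
cotensor product trades the left coaction on `P` for the right coaction on `A`, and `a_(0) a_(1)^[1]
⊗_B a_(1)^[2] = 1 ⊗_B a` collapses the expression to `s ⊗ t` (`canInv_mulFst_tensorCoaction`). -/

theorem BalTensor.induction_on {p : BalTensor α β → Prop} (x : BalTensor α β) (zero : p 0)
    (mk : ∀ m n, p (BalTensor.mk α β m n)) (add : ∀ x y, p x → p y → p (x + y)) : p x := by
  obtain ⟨z, rfl⟩ := Submodule.mkQ_surjective _ x
  induction z using TensorProduct.induction_on with
  | zero => simpa using zero
  | tmul m n => exact mk m n
  | add x y hx hy => rw [map_add]; exact add _ _ hx hy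

theorem BalTensor.hom_ext {f g : BalTensor α β →ₗ[K] V}
    (h : ∀ m n, f (BalTensor.mk α β m n) = g (BalTensor.mk α β m n)) : f = g := by
  ext m n
  exact h m n

/-- `BalTensor.map` for a pair of isomorphisms. -/
def BalTensor.congr (f : M ≃ₗ[K] M') (g : N ≃ₗ[K] N') (hf : ∀ m r, f (α m r) = α' (f m) r)
    (hg : ∀ r n, g (β r n) = β' r (g n)) : BalTensor α β ≃ₗ[K] BalTensor α' β' :=
  LinearEquiv.ofLinearMap (BalTensor.map f.toLinearMap g.toLinearMap hf hg)
    (BalTensor.map f.symm.toLinearMap g.symm.toLinearMap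
      (fun m r => f.injective (by simp [hf])) (fun r n => g.injective (by simp [hg])))
    (BalTensor.hom_ext fun m n => by simp)
    (BalTensor.hom_ext fun m n => by simp)

/-- A bilinear map respecting the relations descends to `M ⊗_R N`. -/
def BalTensor.lift₂ (f : M →ₗ[K] N →ₗ[K] V) (hf : ∀ m r n, f (α m r) n = f m (β r n)) :
    BalTensor α β →ₗ[K] V :=
  BalTensor.lift α β (TensorProduct.lift f) (by simpa using hf)

@[simp] theorem BalTensor.lift₂_mk (f : M →ₗ[K] N →ₗ[K] V)
    (hf : ∀ m r n, f (α m r) n = f m (β r n)) (m : M) (n : N) :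
    BalTensor.lift₂ f hf (BalTensor.mk α β m n) = f m n := rfl

/-- The action of `T` on `M ⊗_R N` induced by a left action of `T` on `M`. -/
def BalTensor.leftActFst {T : Type u} [Ring T] [Algebra K T] (δ : T →ₗ[K] M →ₗ[K] M)
    (h : ∀ t m r, δ t (α m r) = α (δ t m) r) : T →ₗ[K] BalTensor α β →ₗ[K] BalTensor α β where
  toFun t := BalTensor.map (δ t) LinearMap.id (h t) fun _ _ => rfl
  map_add' s t := BalTensor.hom_ext fun m n => by simp
  map_smul' k t := BalTensor.hom_ext fun m n => by simp

@[simp] theorem BalTensor.leftActFst_mk {T : Type u} [Ring T] [Algebra K T]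
    (δ : T →ₗ[K] M →ₗ[K] M) (h : ∀ t m r, δ t (α m r) = α (δ t m) r) (t : T) (m : M) (n : N) :
    BalTensor.leftActFst (β := β) δ h t (BalTensor.mk α β m n) = BalTensor.mk α β (δ t m) n := rfl

/-- The action of `T` on `M ⊗_R N` induced by a left action of `T` on `N`. -/
def BalTensor.leftActSnd {T : Type u} [Ring T] [Algebra K T] (δ : T →ₗ[K] N →ₗ[K] N)
    (h : ∀ t r n, δ t (β r n) = β r (δ t n)) : T →ₗ[K] BalTensor α β →ₗ[K] BalTensor α β where
  toFun t := BalTensor.map LinearMap.id (δ t) (fun _ _ => rfl) (h t)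
  map_add' s t := BalTensor.hom_ext fun m n => by simp
  map_smul' k t := BalTensor.hom_ext fun m n => by simp

@[simp] theorem BalTensor.leftActSnd_mk {T : Type u} [Ring T] [Algebra K T]
    (δ : T →ₗ[K] N →ₗ[K] N) (h : ∀ t r n, δ t (β r n) = β r (δ t n)) (t : T) (m : M) (n : N) :
    BalTensor.leftActSnd (α := α) δ h t (BalTensor.mk α β m n) = BalTensor.mk α β m (δ t n) := rfl

/-- The right action of `T` on `M ⊗_R N` induced by a right action of `T` on `N`. -/
def BalTensor.rightActSnd {T : Type u} [Ring T] [Algebra K T] (δ : N →ₗ[K] T →ₗ[K] N)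
    (h : ∀ r n t, δ (β r n) t = β r (δ n t)) : BalTensor α β →ₗ[K] T →ₗ[K] BalTensor α β :=
  (BalTensor.leftActSnd (α := α) δ.flip fun t r n => h r n t).flip

@[simp] theorem BalTensor.rightActSnd_mk {T : Type u} [Ring T] [Algebra K T]
    (δ : N →ₗ[K] T →ₗ[K] N) (h : ∀ r n t, δ (β r n) t = β r (δ n t)) (m : M) (n : N) (t : T) :
    BalTensor.rightActSnd (α := α) δ h (BalTensor.mk α β m n) t = BalTensor.mk α β m (δ n t) := rfl

end Balanced


/-! ### Associativity and interchange isomorphisms for balanced tensor products. -/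

section Isomorphisms

variable {K : Type u} [CommRing K] {R : Type u} [Ring R] [Algebra K R]
  {M N Q : Type u} [AddCommGroup M] [Module K M] [AddCommGroup N] [Module K N]
  [AddCommGroup Q] [Module K Q] {T : Type u} [Ring T] [Algebra K T]

section Assoc

variable {α : M →ₗ[K] R →ₗ[K] M} {β : R →ₗ[K] N →ₗ[K] N} {γ : N →ₗ[K] T →ₗ[K] N}
  {δ : T →ₗ[K] Q →ₗ[K] Q}

/-- The associativity isomorphism `M ⊗_R (N ⊗_T Q) ≅ (M ⊗_R N) ⊗_T Q`. -/
def BalTensor.assoc (h : ∀ r n t, γ (β r n) t = β r (γ n t)) :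
    BalTensor α (BalTensor.leftActFst (β := δ) β fun r n t => (h r n t).symm) ≃ₗ[K]
      BalTensor (BalTensor.rightActSnd (α := α) γ h) δ :=
  LinearEquiv.ofLinearMap
    (BalTensor.lift₂
      { toFun := fun m => BalTensor.lift₂
          (BalTensor.mk (BalTensor.rightActSnd (α := α) γ h) δ ∘ₗ BalTensor.mk α β m)
          (fun n t q => by
            simpa using BalTensor.mk_balanced (BalTensor.rightActSnd (α := α) γ h) δ
              (BalTensor.mk α β m n) t q)
        map_add' := fun _ _ => BalTensor.hom_ext fun _ _ => by simp
        map_smul' := fun _ _ => BalTensor.hom_ext fun _ _ => by simp }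
      (fun m r x => by
        induction x using BalTensor.induction_on with
        | zero => simp
        | mk n q => simp [BalTensor.mk_balanced]
        | add x y hx hy => simp only [map_add, hx, hy]))
    (BalTensor.lift₂
      -- The balanced variable lies in `M ⊗_R N`, so the map is first descended there for each fixed
      -- `q`; the flip restores the order of the arguments.
      (LinearMap.flip
        { toFun := fun q => BalTensor.lift₂
            ((BalTensor.mk α (BalTensor.leftActFst (β := δ) β fun r n t => (h r n t).symm)).compl₂
              ((BalTensor.mk γ δ).flip q))
            (fun m r n => by
              simpa using BalTensor.mk_balanced α
                (BalTensor.leftActFst (β := δ) β fun r n t => (h r n t).symm) m r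
                (BalTensor.mk γ δ n q))
          map_add' := fun _ _ => BalTensor.hom_ext fun _ _ => by simp
          map_smul' := fun _ _ => BalTensor.hom_ext fun _ _ => by simp })
      (fun x t q => by
        induction x using BalTensor.induction_on with
        | zero => simp
        | mk m n => simp [BalTensor.mk_balanced]
        | add x y hx hy => simp only [map_add, LinearMap.add_apply, hx, hy]))
    (BalTensor.hom_ext fun x q => by
      induction x using BalTensor.induction_on with
      | zero => simp
      | mk m n => simp
      | add x y hx hy => simp only [map_add, LinearMap.add_apply, hx, hy])
    (BalTensor.hom_ext fun m x => by
      induction x using BalTensor.induction_on with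
      | zero => simp
      | mk n q => simp
      | add x y hx hy => simp only [map_add, hx, hy])

end Assoc

section Swap

variable (α : M →ₗ[K] R →ₗ[K] M) (γ : N →ₗ[K] T →ₗ[K] N) {β : R →ₗ[K] Q →ₗ[K] Q}
  {δ : T →ₗ[K] Q →ₗ[K] Q}

/-- The map `M ⊗_R (N ⊗_T Q) → N ⊗_T (M ⊗_R Q)`, `m ⊗ (n ⊗ q) ↦ n ⊗ (m ⊗ q)`. -/
def BalTensor.swapHom (h : ∀ r t q, β r (δ t q) = δ t (β r q)) :
    BalTensor α (BalTensor.leftActSnd (α := γ) β h) →ₗ[K]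
      BalTensor γ (BalTensor.leftActSnd (α := α) δ fun t r q => (h r t q).symm) :=
  BalTensor.lift₂
    { toFun := fun m => BalTensor.lift₂
        ((BalTensor.mk γ (BalTensor.leftActSnd (α := α) δ fun t r q => (h r t q).symm)).compl₂
          (BalTensor.mk α β m))
        (fun n t q => by
          simpa using BalTensor.mk_balanced γ
            (BalTensor.leftActSnd (α := α) δ fun t r q => (h r t q).symm) n t (BalTensor.mk α β m q))
      map_add' := fun _ _ => BalTensor.hom_ext fun _ _ => by simp
      map_smul' := fun _ _ => BalTensor.hom_ext fun _ _ => by simp }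
    (fun m r x => by
      induction x using BalTensor.induction_on with
      | zero => simp
      | mk n q => simp [BalTensor.mk_balanced]
      | add x y hx hy => simp only [map_add, hx, hy])

@[simp] theorem BalTensor.swapHom_mk (h : ∀ r t q, β r (δ t q) = δ t (β r q)) (m : M) (n : N)
    (q : Q) : BalTensor.swapHom α γ h (BalTensor.mk _ _ m (BalTensor.mk _ _ n q)) =
      BalTensor.mk _ _ n (BalTensor.mk _ _ m q) := rfl

/-- The isomorphism `M ⊗_R (N ⊗_T Q) ≅ N ⊗_T (M ⊗_R Q)`. -/
def BalTensor.swap (h : ∀ r t q, β r (δ t q) = δ t (β r q)) :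
    BalTensor α (BalTensor.leftActSnd (α := γ) β h) ≃ₗ[K]
      BalTensor γ (BalTensor.leftActSnd (α := α) δ fun t r q => (h r t q).symm) :=
  LinearEquiv.ofLinearMap (BalTensor.swapHom α γ h)
    (BalTensor.swapHom γ α fun t r q => (h r t q).symm)
    (BalTensor.hom_ext fun n x => by
      induction x using BalTensor.induction_on with
      | zero => simp
      | mk m q => simp
      | add x y hx hy => simp only [map_add, hx, hy])
    (BalTensor.hom_ext fun m x => by
      induction x using BalTensor.induction_on with
      | zero => simp
      | mk n q => simp
      | add x y hx hy => simp only [map_add, hx, hy])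

end Swap

section Scalars

variable (α : M →ₗ[K] R →ₗ[K] M) (β : R →ₗ[K] N →ₗ[K] N) (V : Type u) [AddCommGroup V]
  [Module K V]

/-- The map `M ⊗_R (N ⊗ V) → (M ⊗_R N) ⊗ V`. -/
def BalTensor.tensorRightHom :
    BalTensor α (LinearMap.rTensorHom V ∘ₗ β) →ₗ[K] BalTensor α β ⊗[K] V :=
  BalTensor.lift₂ (LinearMap.rTensorHom V ∘ₗ BalTensor.mk α β)
    (fun m r x => by
      induction x using TensorProduct.induction_on with
      | zero => simp
      | tmul n v => simp [BalTensor.mk_balanced]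
      | add x y hx hy => simp only [map_add, hx, hy])

@[simp] theorem BalTensor.tensorRightHom_mk (m : M) (n : N) (v : V) :
    BalTensor.tensorRightHom α β V (BalTensor.mk _ _ m (n ⊗ₜ[K] v)) =
      BalTensor.mk α β m n ⊗ₜ[K] v := rfl

/-- For fixed `v`, the map `m ⊗_R n ↦ m ⊗_R (n ⊗ v)`. -/
def BalTensor.tensorRightInvAux (v : V) :
    BalTensor α β →ₗ[K] BalTensor α (LinearMap.rTensorHom V ∘ₗ β) :=
  BalTensor.map LinearMap.id ((TensorProduct.mk K N V).flip v) (by simp) (by simp)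

@[simp] theorem BalTensor.tensorRightInvAux_mk (m : M) (n : N) (v : V) :
    BalTensor.tensorRightInvAux α β V v (BalTensor.mk α β m n) =
      BalTensor.mk _ _ m (n ⊗ₜ[K] v) := rfl

/-- The map `(M ⊗_R N) ⊗ V → M ⊗_R (N ⊗ V)`. -/
def BalTensor.tensorRightInv :
    BalTensor α β ⊗[K] V →ₗ[K] BalTensor α (LinearMap.rTensorHom V ∘ₗ β) :=
  TensorProduct.lift
    (LinearMap.flip
      { toFun := BalTensor.tensorRightInvAux α β V
        map_add' := fun _ _ => BalTensor.hom_ext fun _ _ => by simp [TensorProduct.tmul_add]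
        map_smul' := fun _ _ => BalTensor.hom_ext fun _ _ => by simp })

@[simp] theorem BalTensor.tensorRightInv_mk (m : M) (n : N) (v : V) :
    BalTensor.tensorRightInv α β V (BalTensor.mk α β m n ⊗ₜ[K] v) =
      BalTensor.mk _ _ m (n ⊗ₜ[K] v) := rfl

/-- The isomorphism `M ⊗_R (N ⊗ V) ≅ (M ⊗_R N) ⊗ V`. -/
def BalTensor.tensorRight :
    BalTensor α (LinearMap.rTensorHom V ∘ₗ β) ≃ₗ[K] BalTensor α β ⊗[K] V :=
  LinearEquiv.ofLinearMap (BalTensor.tensorRightHom α β V) (BalTensor.tensorRightInv α β V)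
    (TensorProduct.ext' fun x v => by
      induction x using BalTensor.induction_on with
      | zero => simp
      | mk m n =>
        rw [LinearMap.comp_apply, BalTensor.tensorRightInv_mk, BalTensor.tensorRightHom_mk]; rfl
      | add x y hx hy => rw [TensorProduct.add_tmul, map_add, hx, hy, map_add])
    (BalTensor.hom_ext fun m x => by
      induction x using TensorProduct.induction_on with
      | zero => rw [map_zero, map_zero, map_zero]
      | tmul n v =>
        rw [LinearMap.comp_apply, BalTensor.tensorRightHom_mk, BalTensor.tensorRightInv_mk]; rfl
      | add x y hx hy => rw [map_add, map_add, hx, hy, map_add])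

/-- The isomorphism `M ⊗_R (V ⊗ N) ≅ V ⊗ (M ⊗_R N)`. -/
def BalTensor.tensorLeft :
    BalTensor α (LinearMap.lTensorHom V ∘ₗ β) ≃ₗ[K] V ⊗[K] BalTensor α β :=
  BalTensor.congr (LinearEquiv.refl K M) (TensorProduct.comm K V N) (by simp)
    (fun r x => by
      induction x using TensorProduct.induction_on with
      | zero => simp
      | tmul n v => simp
      | add x y hx hy => simp only [map_add, hx, hy]) ≪≫ₗ
  BalTensor.tensorRight α β V ≪≫ₗ TensorProduct.comm K _ V

end Scalars

section Exchange

variable {A B P D : Type u} [Ring A] [Algebra K A] [Ring B] [Algebra K B] [Ring P] [Algebra K P]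
  [Ring D] [Algebra K D] (i : B →ₐ[K] A) (j : D →ₐ[K] P)

/-- `(A ⊗ P) ⊗_{B ⊗ D} Q ≅ A ⊗_B (P ⊗_D Q)`, for commuting left actions of `B` and `D` on `Q`. -/
def BalTensor.exchange {γ : B ⊗[K] D →ₗ[K] Q →ₗ[K] Q} {β : B →ₗ[K] Q →ₗ[K] Q}
    {δ : D →ₗ[K] Q →ₗ[K] Q} (h : ∀ b d q, β b (δ d q) = δ d (β b q))
    (hγ : ∀ b d q, γ (b ⊗ₜ[K] d) q = β b (δ d q)) (hβ : ∀ b q, γ (b ⊗ₜ[K] 1) q = β b q)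
    (hδ : ∀ d q, γ (1 ⊗ₜ[K] d) q = δ d q) :
    BalTensor (rightAct (Algebra.TensorProduct.map i j)) γ ≃ₗ[K]
      BalTensor (rightAct i) (BalTensor.leftActSnd (α := rightAct j) β h) :=
  LinearEquiv.ofLinearMap
    (BalTensor.lift₂
      (TensorProduct.lift (LinearMap.mk₂ K (fun a p => BalTensor.mk _ _ a ∘ₗ BalTensor.mk _ _ p)
        (fun _ _ _ => LinearMap.ext fun _ => by simp)
        (fun _ _ _ => LinearMap.ext fun _ => by simp)
        (fun _ _ _ => LinearMap.ext fun _ => by simp)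
        (fun _ _ _ => LinearMap.ext fun _ => by simp)))
      (fun u r q => by
        induction u using TensorProduct.induction_on with
        | zero => simp
        | add x y hx hy => simp only [map_add, LinearMap.add_apply, hx, hy]
        | tmul a p =>
          induction r using TensorProduct.induction_on with
          | zero => simp
          | add x y hx hy => simp only [map_add, LinearMap.add_apply, hx, hy]
          | tmul b d =>
            -- An elementary `b ⊗ d` crosses in two moves: `b` over the outer tensor product, then
            -- `d` over the inner one. Commutation of the two actions matches the resulting order
            -- with `hγ`.
            have h1 := BalTensor.mk_balanced (rightAct i)
              (BalTensor.leftActSnd (α := rightAct j) β h) a b (BalTensor.mk _ _ (p * j d) q)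
            have h2 := BalTensor.mk_balanced (rightAct j) δ p d (β b q)
            simp only [rightAct_apply, BalTensor.leftActSnd_mk] at h1 h2
            simp [h1, h2, hγ, h]))
    (BalTensor.lift₂
      { toFun := fun a => BalTensor.lift₂
          (BalTensor.mk (rightAct (Algebra.TensorProduct.map i j)) γ ∘ₗ TensorProduct.mk K A P a)
          (fun p d q => by
            have := BalTensor.mk_balanced (rightAct (Algebra.TensorProduct.map i j)) γ
              (a ⊗ₜ[K] p) (1 ⊗ₜ[K] d) q
            simpa [hδ] using this)
        map_add' := fun _ _ => BalTensor.hom_ext fun _ _ => by simp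
        map_smul' := fun _ _ => BalTensor.hom_ext fun _ _ => by simp }
      (fun a b x => by
        induction x using BalTensor.induction_on with
        | zero => simp
        | add x y hx hy => simp only [map_add, hx, hy]
        | mk p q =>
          have := BalTensor.mk_balanced (rightAct (Algebra.TensorProduct.map i j)) γ
            (a ⊗ₜ[K] p) (b ⊗ₜ[K] 1) q
          simpa [hβ] using this))
    (BalTensor.hom_ext fun a x => by
      induction x using BalTensor.induction_on with
      | zero => simp
      | add x y hx hy => simp only [map_add, hx, hy]
      | mk p q => simp)
    (BalTensor.hom_ext fun u q => by
      induction u using TensorProduct.induction_on with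
      | zero => simp
      | add x y hx hy => simp only [map_add, LinearMap.add_apply, hx, hy]
      | tmul a p => simp)

end Exchange

end Isomorphisms


/-! ### Faithful flatness in terms of actions given by bilinear maps. -/

section FaithfullyFlat

variable {K : Type u} [CommRing K] {R S : Type u} [Ring R] [Algebra K R] [Ring S] [Algebra K S]
  {N N' N'' : Type u} [AddCommGroup N] [Module K N] [AddCommGroup N'] [Module K N']
  [AddCommGroup N''] [Module K N'']

/-- `β` makes `N` a unital left `R`-module. -/
structure IsLeftAction (β : R →ₗ[K] N →ₗ[K] N) : Prop where
  one : ∀ n, β 1 n = n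
  mul : ∀ r s n, β (r * s) n = β r (β s n)

/-- The module structure of a unital left action. -/
abbrev IsLeftAction.module {β : R →ₗ[K] N →ₗ[K] N} (h : IsLeftAction β) : Module R N where
  smul r n := β r n
  one_smul := h.one
  mul_smul := h.mul
  smul_zero r := map_zero (β r)
  smul_add r := map_add (β r)
  add_smul r s n := by
    change β (r + s) n = β r n + β s n
    rw [map_add, LinearMap.add_apply]
  zero_smul n := by
    change β 0 n = 0
    rw [map_zero, LinearMap.zero_apply]

theorem IsLeftAction.isScalarTower {β : R →ₗ[K] N →ₗ[K] N} (h : IsLeftAction β) :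
    letI := h.module
    IsScalarTower K R N :=
  let := h.module
  ⟨fun k r n => by
    change β (k • r) n = k • β r n
    rw [map_smul, LinearMap.smul_apply]⟩

theorem isLeftAction_leftModAct [Module R N] [IsScalarTower K R N] :
    IsLeftAction (leftModAct K R N) :=
  ⟨fun n => one_smul R n, fun r s n => mul_smul r s n⟩

theorem isLeftAction_leftAct (f : R →ₐ[K] S) : IsLeftAction (leftAct f) :=
  ⟨fun n => by simp, fun r s n => by simp [mul_assoc]⟩

theorem IsLeftAction.rTensor {β : R →ₗ[K] N →ₗ[K] N} (h : IsLeftAction β) (V : Type u)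
    [AddCommGroup V] [Module K V] : IsLeftAction (LinearMap.rTensorHom V ∘ₗ β) where
  one x := by
    induction x using TensorProduct.induction_on with
    | zero => simp
    | tmul v n => simp [h.one]
    | add x y hx hy => rw [map_add, hx, hy]
  mul r s x := by
    induction x using TensorProduct.induction_on with
    | zero => simp
    | tmul v n => simp [h.mul]
    | add x y hx hy => simp only [map_add, hx, hy]

theorem IsLeftAction.comp {β : R →ₗ[K] N →ₗ[K] N} (h : IsLeftAction β) {T : Type u} [Ring T]
    [Algebra K T] (f : T →ₐ[K] R) : IsLeftAction (β ∘ₗ f.toLinearMap) :=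
  ⟨fun n => by simp [h.one], fun r s n => by simp [h.mul]⟩

theorem IsLeftAction.leftActFst {T : Type u} [Ring T] [Algebra K T] {δ : T →ₗ[K] N →ₗ[K] N}
    (hδ : IsLeftAction δ) {α : N →ₗ[K] R →ₗ[K] N} {β : R →ₗ[K] N' →ₗ[K] N'}
    (h : ∀ t m r, δ t (α m r) = α (δ t m) r) :
    IsLeftAction (BalTensor.leftActFst (β := β) δ h) where
  one x := by
    induction x using BalTensor.induction_on with
    | zero => simp
    | mk m n => simp [hδ.one]
    | add x y hx hy => rw [map_add, hx, hy]
  mul r s x := by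
    induction x using BalTensor.induction_on with
    | zero => simp
    | mk m n => simp [hδ.mul]
    | add x y hx hy => simp only [map_add, hx, hy]

theorem IsLeftAction.leftActSnd {T : Type u} [Ring T] [Algebra K T] {δ : T →ₗ[K] N' →ₗ[K] N'}
    (hδ : IsLeftAction δ) {α : N →ₗ[K] R →ₗ[K] N} {β : R →ₗ[K] N' →ₗ[K] N'}
    (h : ∀ t r n, δ t (β r n) = β r (δ t n)) :
    IsLeftAction (BalTensor.leftActSnd (α := α) δ h) where
  one x := by
    induction x using BalTensor.induction_on with
    | zero => simp
    | mk m n => simp [hδ.one]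
    | add x y hx hy => rw [map_add, hx, hy]
  mul r s x := by
    induction x using BalTensor.induction_on with
    | zero => simp
    | mk m n => simp [hδ.mul]
    | add x y hx hy => simp only [map_add, hx, hy]

variable {f : R →ₐ[K] S} {β : R →ₗ[K] N →ₗ[K] N} {β' : R →ₗ[K] N' →ₗ[K] N'}
  {β'' : R →ₗ[K] N'' →ₗ[K] N''}

/-- `M ⊗_R g : M ⊗_R N → M ⊗_R N'` for a map `g : N → N'` of left `R`-modules. -/
def BalTensor.lTensor {M : Type u} [AddCommGroup M] [Module K M] (α : M →ₗ[K] R →ₗ[K] M)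
    (g : N →ₗ[K] N') (hg : ∀ r n, g (β r n) = β' r (g n)) : BalTensor α β →ₗ[K] BalTensor α β' :=
  BalTensor.map LinearMap.id g (fun _ _ => rfl) hg

@[simp] theorem BalTensor.lTensor_mk {M : Type u} [AddCommGroup M] [Module K M]
    (α : M →ₗ[K] R →ₗ[K] M) (g : N →ₗ[K] N') (hg : ∀ r n, g (β r n) = β' r (g n)) (m : M)
    (n : N) : BalTensor.lTensor α g hg (BalTensor.mk α β m n) = BalTensor.mk α β' m (g n) := rfl

/-- Faithful flatness is defined by quantifying over module instances, whereas iterated tensor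
products such as `P ⊗_D N` carry their remaining actions only as bilinear maps. This version applies
to the latter directly. -/
theorem IsRightFaithfullyFlat.exact_iff (hf : IsRightFaithfullyFlat f) (h : IsLeftAction β)
    (h' : IsLeftAction β') (h'' : IsLeftAction β'') (g : N →ₗ[K] N') (g' : N' →ₗ[K] N'')
    (hg : ∀ r n, g (β r n) = β' r (g n)) (hg' : ∀ r n, g' (β' r n) = β'' r (g' n)) :
    Function.Exact (BalTensor.lTensor (rightAct f) g hg) (BalTensor.lTensor (rightAct f) g' hg') ↔
      Function.Exact g g' := by
  let := h.module
  let := h'.module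
  let := h''.module
  have := h.isScalarTower
  have := h'.isScalarTower
  have := h''.isScalarTower
  -- For the instances built from the actions, `leftModAct` unfolds to the original action, so the
  -- two statements agree by definition.
  exact hf N N' N'' { g with map_smul' := hg } { g' with map_smul' := hg' }

/-- Injectivity is exactness after a zero arrow, and a zero arrow stays zero under tensoring; the
zero endomorphism of `N` serves as that arrow. -/
theorem IsRightFaithfullyFlat.injective_iff (hf : IsRightFaithfullyFlat f) (h : IsLeftAction β)
    (h' : IsLeftAction β') (g : N →ₗ[K] N') (hg : ∀ r n, g (β r n) = β' r (g n)) :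
    Function.Injective (BalTensor.lTensor (rightAct f) g hg) ↔ Function.Injective g := by
  have := hf.exact_iff h h h' 0 g (fun r n => by simp) hg
  have e : BalTensor.lTensor (rightAct f) (0 : N →ₗ[K] N) (fun r n => by simp) =
      (0 : BalTensor (rightAct f) β →ₗ[K] BalTensor (rightAct f) β) :=
    BalTensor.hom_ext fun m n => by simp
  rw [e] at this
  rw [← LinearMap.ker_eq_bot, ← LinearMap.ker_eq_bot]
  simpa [LinearMap.exact_iff] using this

/-- Dually, surjectivity is exactness before the zero endomorphism of `N'`. -/
theorem IsRightFaithfullyFlat.surjective_iff (hf : IsRightFaithfullyFlat f) (h : IsLeftAction β)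
    (h' : IsLeftAction β') (g : N →ₗ[K] N') (hg : ∀ r n, g (β r n) = β' r (g n)) :
    Function.Surjective (BalTensor.lTensor (rightAct f) g hg) ↔ Function.Surjective g := by
  have := hf.exact_iff h h' h' g 0 hg (fun r n => by simp)
  have e : BalTensor.lTensor (rightAct f) (0 : N' →ₗ[K] N') (fun r n => by simp) =
      (0 : BalTensor (rightAct f) β' →ₗ[K] BalTensor (rightAct f) β') :=
    BalTensor.hom_ext fun m n => by simp
  rw [e] at this
  rw [← LinearMap.range_eq_top, ← LinearMap.range_eq_top]
  simpa [LinearMap.exact_iff, eq_comm] using this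

theorem IsRightFaithfullyFlat.bijective_iff (hf : IsRightFaithfullyFlat f) (h : IsLeftAction β)
    (h' : IsLeftAction β') (g : N →ₗ[K] N') (hg : ∀ r n, g (β r n) = β' r (g n)) :
    Function.Bijective (BalTensor.lTensor (rightAct f) g hg) ↔ Function.Bijective g :=
  and_congr (hf.injective_iff h h' g hg) (hf.surjective_iff h h' g hg)

end FaithfullyFlat


/-! ### The base of a faithfully flat extension as its coinvariants. -/

section Descent

variable {K : Type u} [CommRing K] {C : Type u} [AddCommGroup C] [Module K C]
  {B P : Type u} [Ring B] [Algebra K B] [Ring P] [Algebra K P]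

/-- `mulFst` as a bilinear map. -/
def mulFstHom (K : Type u) [CommRing K] (P : Type u) [Ring P] [Algebra K P] (C : Type u)
    [AddCommGroup C] [Module K C] : P →ₗ[K] P ⊗[K] C →ₗ[K] P ⊗[K] C :=
  LinearMap.rTensorHom C ∘ₗ LinearMap.mul K P

@[simp] theorem mulFstHom_apply (p : P) (x : P ⊗[K] C) : mulFstHom K P C p x = mulFst C p x := rfl

@[simp] theorem rTensorHom_leftAct_apply (i : B →ₐ[K] P) (b : B) (x : P ⊗[K] C) :
    (LinearMap.rTensorHom C ∘ₗ leftAct i) b x = mulFst C (i b) x := rfl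

theorem mulFst_one (x : P ⊗[K] C) : mulFst C 1 x = x := by
  have := mulFst_algebraMap (P := P) (1 : K) x
  rwa [map_one, one_smul] at this

theorem can_mk (i : B →ₐ[K] P) (ρ : P →ₗ[K] P ⊗[K] C) (h : i.range ≤ coinv ρ) (p q : P) :
    can i ρ h (BalTensor.mk _ _ p q) = mulFst C p (ρ q) := by
  simp only [can, BalTensor.lift_mk, canLift_tmul]

variable (i : B →ₐ[K] P)

/-- The multiplication `P ⊗_B (P ⊗ C) → P ⊗ C`. -/
def extMulFst (C : Type u) [AddCommGroup C] [Module K C] :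
    BalTensor (rightAct i) (LinearMap.rTensorHom C ∘ₗ leftAct i) →ₗ[K] P ⊗[K] C :=
  BalTensor.lift₂ (mulFstHom K P C) (fun p b x => by
    rw [rTensorHom_leftAct_apply, rightAct_apply, mulFstHom_apply, mulFstHom_apply, mulFst_mul])

@[simp] theorem extMulFst_mk (p : P) (x : P ⊗[K] C) :
    extMulFst i C (BalTensor.mk _ _ p x) = mulFst C p x := rfl

/-- The multiplication `P ⊗_B P → P`. -/
def extMul : ExtTensor i →ₗ[K] P :=
  BalTensor.lift₂ (LinearMap.mul K P) (fun p b x => by simp [mul_assoc])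

@[simp] theorem extMul_mk (p q : P) : extMul i (BalTensor.mk _ _ p q) = p * q := rfl

variable {i}

/-- The regular left `B`-module is encoded as the action through `AlgHom.id`, which makes `i` an
arrow to which faithful flatness applies. -/
theorem toLinearMap_leftAct (b c : B) :
    i.toLinearMap (leftAct (AlgHom.id K B) b c) = leftAct i b (i.toLinearMap c) := by
  simp

/-- After `P ⊗_B -` the map `i` becomes `P ⊗_B B → P ⊗_B P`, which is split by multiplication;
faithful flatness reflects the injectivity. -/
theorem IsRightFaithfullyFlat.injective (hf : IsRightFaithfullyFlat i) : Function.Injective i := by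
  refine (hf.injective_iff (isLeftAction_leftAct (AlgHom.id K B)) (isLeftAction_leftAct i)
    i.toLinearMap toLinearMap_leftAct).1 ?_
  refine Function.LeftInverse.injective
    (g := fun z => BalTensor.mk (rightAct i) (leftAct (AlgHom.id K B)) (extMul i z) 1) fun x => ?_
  induction x using BalTensor.induction_on with
  | zero => simp
  | add x y hx hy =>
    simp only [map_add, LinearMap.add_apply] at hx hy ⊢
    rw [hx, hy]
  | mk p b =>
    have := BalTensor.mk_balanced (rightAct i) (leftAct (AlgHom.id K B)) p b 1
    simpa using this

/-- The base of a faithfully flat extension with injective canonical map is the algebra of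
coinvariants. -/
theorem IsRightFaithfullyFlat.range_eq_coinv (hf : IsRightFaithfullyFlat i)
    {ρ : P →ₗ[K] P ⊗[K] C} (h : i.range ≤ coinv ρ) (hc : Function.Injective (can i ρ h)) :
    i.range = coinv ρ := by
  refine le_antisymm h fun s hs => ?_
  -- The map `p ↦ ρ(p) - p ρ(1)` is left `B`-linear and kills every coinvariant (take `p = 1` in the
  -- definition). It remains to show that its kernel is the image of `B`, by testing exactness of `B
  -- → P → P ⊗ C` after `P ⊗_B -`.
  let δ : P →ₗ[K] P ⊗[K] C := ρ - (mulFstHom K P C).flip (ρ 1)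
  have hi (b : B) (p : P) : ρ (i b * p) = mulFst C (i b) (ρ p) := mem_coinv.1 (h ⟨b, rfl⟩) p
  have hδ (p : P) : δ p = ρ p - mulFst C p (ρ 1) := rfl
  have hδl (b : B) (p : P) :
      δ (leftAct i b p) = (LinearMap.rTensorHom C ∘ₗ leftAct i) b (δ p) := by
    rw [rTensorHom_leftAct_apply, leftAct_apply, hδ, hδ, map_sub, ← mulFst_mul, hi]
  have hδi (b : B) : δ (i b) = 0 := by
    have := hi b 1
    rw [mul_one] at this
    rw [hδ, this, sub_self]
  have key : ∀ z, extMulFst i C (BalTensor.lTensor (rightAct i) δ hδl z) =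
      can i ρ h z - can i ρ h (BalTensor.mk _ _ (extMul i z) 1) := by
    intro z
    induction z using BalTensor.induction_on with
    | zero => simp
    | mk p q => simp only [BalTensor.lTensor_mk, extMulFst_mk, hδ, can_mk, extMul_mk, map_sub,
        mulFst_mul]
    | add x y hx hy =>
      simp only [map_add, LinearMap.add_apply, hx, hy]
      abel
  have hex := (hf.exact_iff (isLeftAction_leftAct (AlgHom.id K B)) (isLeftAction_leftAct i)
    ((isLeftAction_leftAct i).rTensor C) i.toLinearMap δ toLinearMap_leftAct hδl).1 ?_
  · obtain ⟨b, hb⟩ := (hex s).1 (by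
      have := mem_coinv.1 hs 1
      rw [mul_one] at this
      rw [hδ, this, sub_self])
    exact ⟨b, hb⟩
  · intro z
    constructor
    -- With the left side of `key` zero, injectivity of the canonical map forces `z = μ(z) ⊗_B 1`
    -- for the multiplication `μ`, an element coming from `P ⊗_B B`.
    · intro hz
      have h1 := key z
      rw [hz, map_zero, eq_comm, sub_eq_zero] at h1
      exact ⟨BalTensor.mk _ _ (extMul i z) 1, by simpa using (hc h1).symm⟩
    · rintro ⟨w, rfl⟩
      induction w using BalTensor.induction_on with
      | zero => simp
      | mk p q => simp [hδi]
      | add x y hx hy => rw [map_add, map_add, hx, hy, add_zero]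

end Descent


/-! ### Descent for the cotensor product: `A ⊗_B (A □_H P) ≅ A ⊗ P`. -/

section Cotensor

variable {K : Type u} [CommRing K] {H : Type u} [Ring H] [HopfAlgebra K H]
  {A B P D : Type u} [Ring A] [Algebra K A] [Ring B] [Algebra K B] [Ring P] [Algebra K P]
  [Ring D] [Algebra K D]

theorem tmul_one_mul (a : A) (x : A ⊗[K] P) : (a ⊗ₜ[K] (1 : P)) * x = mulFst P a x := by
  induction x using TensorProduct.induction_on with
  | zero => simp
  | tmul b p => simp
  | add x y hx hy => rw [mul_add, hx, hy, map_add]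

theorem lTensor_mulFst {V W : Type u} [AddCommGroup V] [Module K V] [AddCommGroup W] [Module K W]
    (g : V →ₗ[K] W) (a : A) (x : A ⊗[K] V) :
    g.lTensor A (mulFst V a x) = mulFst W a (g.lTensor A x) := by
  induction x using TensorProduct.induction_on with
  | zero => simp
  | tmul b p => simp
  | add x y hx hy => simp only [map_add, hx, hy]

/-- The coaction on the first factor, `ρ ⊗ V : A ⊗ V → A ⊗ (H ⊗ V)`. -/
def coactFst (ρ : A →ₐ[K] A ⊗[K] H) (V : Type u) [AddCommGroup V] [Module K V] :
    A ⊗[K] V →ₗ[K] A ⊗[K] (H ⊗[K] V) :=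
  (TensorProduct.assoc K A H V).toLinearMap ∘ₗ ρ.toLinearMap.rTensor V

theorem coactFst_tmul (ρ : A →ₐ[K] A ⊗[K] H) {V : Type u} [AddCommGroup V] [Module K V] (a : A)
    (v : V) : coactFst ρ V (a ⊗ₜ[K] v) = TensorProduct.assoc K A H V (ρ a ⊗ₜ[K] v) := rfl

theorem cotensorFst_apply (ρ : A →ₐ[K] A ⊗[K] H) (x : A ⊗[K] P) :
    cotensorFst ρ P x = coactFst ρ P x := by
  induction x using TensorProduct.induction_on with
  | zero => simp
  | tmul a p => rfl
  | add x y hx hy => rw [map_add, map_add, hx, hy]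

theorem cotensorSnd_apply (l : P →ₐ[K] H ⊗[K] P) (x : A ⊗[K] P) :
    cotensorSnd A l x = l.toLinearMap.lTensor A x := by
  induction x using TensorProduct.induction_on with
  | zero => simp
  | tmul a p => rfl
  | add x y hx hy => rw [map_add, map_add, hx, hy]

theorem mem_cotensor {ρ : A →ₐ[K] A ⊗[K] H} {l : P →ₐ[K] H ⊗[K] P} {x : A ⊗[K] P} :
    x ∈ cotensor ρ l ↔ coactFst ρ P x = l.toLinearMap.lTensor A x := by
  rw [← cotensorFst_apply, ← cotensorSnd_apply]
  rfl

theorem coactFst_lTensor (ρ : A →ₐ[K] A ⊗[K] H) {V W : Type u} [AddCommGroup V] [Module K V]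
    [AddCommGroup W] [Module K W] (g : V →ₗ[K] W) (x : A ⊗[K] V) :
    coactFst ρ W (g.lTensor A x) = (g.lTensor H).lTensor A (coactFst ρ V x) := by
  induction x using TensorProduct.induction_on with
  | zero => simp
  | add x y hx hy => simp only [map_add, hx, hy]
  | tmul a v =>
    rw [LinearMap.lTensor_tmul, coactFst_tmul, coactFst_tmul]
    induction ρ a using TensorProduct.induction_on with
    | zero => simp
    | tmul b h => simp
    | add x y hx hy => simp only [TensorProduct.add_tmul, map_add, hx, hy]

/-- Coassociativity of `ρ` with a spectator factor `V`: `h1` and `h2` isolate the two sides of the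
axiom inside the iterated associators. -/
theorem coactFst_coactFst {ρ : A →ₐ[K] A ⊗[K] H} (hρ : IsRightCoaction ρ.toLinearMap) {V : Type u}
    [AddCommGroup V] [Module K V] (x : A ⊗[K] V) :
    coactFst ρ (H ⊗[K] V) (coactFst ρ V x) =
      ((TensorProduct.assoc K H H V).toLinearMap ∘ₗ
        (Coalgebra.comul (R := K) (A := H)).rTensor V).lTensor A (coactFst ρ V x) := by
  induction x using TensorProduct.induction_on with
  | zero => simp
  | add x y hx hy => simp only [map_add, hx, hy]
  | tmul a v =>
    have h1 (z : A ⊗[K] H) : coactFst ρ (H ⊗[K] V) (TensorProduct.assoc K A H V (z ⊗ₜ[K] v)) =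
        (TensorProduct.assoc K H H V).toLinearMap.lTensor A (TensorProduct.assoc K A (H ⊗[K] H) V
          (TensorProduct.assoc K A H H (ρ.toLinearMap.rTensor H z) ⊗ₜ[K] v)) := by
      induction z using TensorProduct.induction_on with
      | zero => simp
      | add x y hx hy => simp only [TensorProduct.add_tmul, map_add, hx, hy]
      | tmul b h =>
        simp only [TensorProduct.assoc_tmul, coactFst_tmul, LinearMap.rTensor_tmul,
          AlgHom.toLinearMap_apply]
        induction ρ b using TensorProduct.induction_on with
        | zero => simp
        | tmul b h => simp
        | add x y hx hy => simp only [TensorProduct.add_tmul, map_add, hx, hy]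
    have h2 (z : A ⊗[K] H) : ((TensorProduct.assoc K H H V).toLinearMap ∘ₗ
        (Coalgebra.comul (R := K) (A := H)).rTensor V).lTensor A
          (TensorProduct.assoc K A H V (z ⊗ₜ[K] v)) =
        (TensorProduct.assoc K H H V).toLinearMap.lTensor A (TensorProduct.assoc K A (H ⊗[K] H) V
          ((Coalgebra.comul (R := K) (A := H)).lTensor A z ⊗ₜ[K] v)) := by
      induction z using TensorProduct.induction_on with
      | zero => simp
      | add x y hx hy => simp only [TensorProduct.add_tmul, map_add, hx, hy]
      | tmul b h => simp
    rw [coactFst_tmul, h1, h2]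
    have := LinearMap.congr_fun hρ.coassoc a
    simp only [LinearMap.comp_apply, LinearEquiv.coe_coe, AlgHom.toLinearMap_apply] at this
    rw [this]

variable {i : B →ₐ[K] A} {ρ : A →ₐ[K] A ⊗[K] H}

/-- The isomorphism `A ⊗_B (A ⊗ V) ≅ A ⊗ (H ⊗ V)` induced by the canonical map. -/
def IsCoalgebraGalois.canTensor (hA : IsCoalgebraGalois i ρ.toLinearMap) (V : Type u)
    [AddCommGroup V] [Module K V] :
    BalTensor (rightAct i) (LinearMap.rTensorHom V ∘ₗ leftAct i) ≃ₗ[K] A ⊗[K] (H ⊗[K] V) :=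
  BalTensor.tensorRight (rightAct i) (leftAct i) V ≪≫ₗ LinearEquiv.rTensor V hA.canEquiv ≪≫ₗ
    TensorProduct.assoc K A H V

/-- The canonical map with a spectator factor, stated for arbitrary `x`: elements of `A □_H P` need
not be elementary tensors. -/
theorem IsCoalgebraGalois.canTensor_mk (hA : IsCoalgebraGalois i ρ.toLinearMap) {V : Type u}
    [AddCommGroup V] [Module K V] (a : A) (x : A ⊗[K] V) :
    hA.canTensor V (BalTensor.mk _ _ a x) = mulFst (H ⊗[K] V) a (coactFst ρ V x) := by
  induction x using TensorProduct.induction_on with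
  | zero => simp
  | add x y hx hy => simp only [map_add, hx, hy]
  | tmul b v =>
    have h1 : hA.canTensor V (BalTensor.mk _ _ a (b ⊗ₜ[K] v)) =
      TensorProduct.assoc K A H V (can i ρ.toLinearMap hA.range_eq.le (BalTensor.mk _ _ a b)
        ⊗ₜ[K] v) := rfl
    rw [h1, can_mk, coactFst_tmul, AlgHom.toLinearMap_apply]
    induction ρ b using TensorProduct.induction_on with
    | zero => simp
    | tmul b h => simp
    | add x y hx hy => simp only [TensorProduct.add_tmul, map_add, hx, hy]

variable {l : P →ₐ[K] H ⊗[K] P} (hi : i.range ≤ coinv ρ.toLinearMap)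

/-- The embedding of `B` into `A □_H P`, `b ↦ b ⊗ 1`. -/
def cotensorBaseLeft (l : P →ₐ[K] H ⊗[K] P) (hi : i.range ≤ coinv ρ.toLinearMap) :
    B →ₐ[K] cotensor ρ l :=
  -- The ground ring stands in for `D`, so that the embedding does not depend on `D`; scalars are
  -- left coinvariant because `l` is an algebra map.
  (cotensorBase ρ l i (Algebra.ofId K P) hi fun k => by
    rw [Algebra.ofId_apply, AlgHom.commutes, Algebra.TensorProduct.algebraMap_apply']).comp
      Algebra.TensorProduct.includeLeft

theorem cotensorBase_tmul_one (j : D →ₐ[K] P) (hj : ∀ d, l (j d) = 1 ⊗ₜ[K] j d) (b : B) :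
    cotensorBase ρ l i j hi hj (b ⊗ₜ[K] 1) = cotensorBaseLeft l hi b :=
  Subtype.ext (by simp [cotensorBaseLeft])

theorem cotensorBaseLeft_coe (b : B) (x : cotensor ρ l) :
    ((cotensorBaseLeft l hi b * x : cotensor ρ l) : A ⊗[K] P) = mulFst P (i b) x := by
  rw [← tmul_one_mul]
  simp [cotensorBaseLeft]

/-- The map `A ⊗_B (A □_H P) → A ⊗ P`, `a ⊗_B x ↦ (a ⊗ 1) x`. -/
def cotensorMul (l : P →ₐ[K] H ⊗[K] P) (hi : i.range ≤ coinv ρ.toLinearMap) :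
    BalTensor (rightAct i) (leftAct (cotensorBaseLeft l hi)) →ₗ[K] A ⊗[K] P :=
  BalTensor.lift₂ ((mulFstHom K A P).compl₂ (cotensor ρ l).val.toLinearMap) (fun a b x => by
    simp only [LinearMap.compl₂_apply, AlgHom.toLinearMap_apply, Subalgebra.coe_val,
      mulFstHom_apply, leftAct_apply, cotensorBaseLeft_coe, rightAct_apply, mulFst_mul])

@[simp] theorem cotensorMul_mk (a : A) (x : cotensor ρ l) :
    cotensorMul l hi (BalTensor.mk _ _ a x) = mulFst P a (x : A ⊗[K] P) := rfl

/-- The counit provides a linear retraction of `l`, which survives tensoring with any module, flat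
or not. -/
theorem IsLeftCoaction.lTensor_injective (hl : IsLeftCoaction l.toLinearMap) (V : Type u)
    [AddCommGroup V] [Module K V] : Function.Injective (l.toLinearMap.lTensor V) := by
  refine Function.LeftInverse.injective
    (g := ((TensorProduct.lid K P).toLinearMap ∘ₗ
      (Coalgebra.counit (R := K) (A := H)).rTensor P).lTensor V) fun x => ?_
  rw [← LinearMap.lTensor_comp_apply, LinearMap.comp_assoc, hl.counit, LinearMap.lTensor_id,
    LinearMap.id_apply]

/-- `A ⊗_B (A □_H P) ≅ A ⊗ P` for a Hopf-Galois extension with `A` faithfully flat over `B`. -/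
theorem cotensorMul_bijective (hA : IsCoalgebraGalois i ρ.toLinearMap)
    (hf : IsRightFaithfullyFlat i) (hl : IsLeftCoaction l.toLinearMap) :
    Function.Bijective (cotensorMul l hA.range_eq.le) := by
  have hi := hA.range_eq.le
  let ι : cotensor ρ l →ₗ[K] A ⊗[K] P := (cotensor ρ l).val.toLinearMap
  have hι (x : cotensor ρ l) : ι x = (x : A ⊗[K] P) := rfl
  have hιl (b : B) (x : cotensor ρ l) :
      ι (leftAct (cotensorBaseLeft l hi) b x) = (LinearMap.rTensorHom P ∘ₗ leftAct i) b (ι x) :=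
    cotensorBaseLeft_coe hi b x
  -- The cotensor product is the kernel of this difference. It is left `B`-linear because `B` is
  -- coinvariant, so the sequence may be tensored over `B`.
  let δ : A ⊗[K] P →ₗ[K] A ⊗[K] (H ⊗[K] P) :=
    (cotensorFst ρ P).toLinearMap - (cotensorSnd A l).toLinearMap
  have hδ (x : A ⊗[K] P) : δ x = coactFst ρ P x - l.toLinearMap.lTensor A x := by
    rw [← cotensorFst_apply, ← cotensorSnd_apply]
    rfl
  have hδl (b : B) (x : A ⊗[K] P) : δ ((LinearMap.rTensorHom P ∘ₗ leftAct i) b x) =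
      (LinearMap.rTensorHom (H ⊗[K] P) ∘ₗ leftAct i) b (δ x) := by
    have hb : ρ (i b) = i b ⊗ₜ[K] 1 := (mem_coinv_iff_of_algHom ρ).1 (hi ⟨b, rfl⟩)
    have h1 : cotensorFst ρ P (i b ⊗ₜ[K] (1 : P)) = i b ⊗ₜ[K] (1 : H ⊗[K] P) := by
      rw [cotensorFst_apply, coactFst_tmul, hb]
      rfl
    rw [rTensorHom_leftAct_apply, rTensorHom_leftAct_apply, hδ, hδ, map_sub, lTensor_mulFst,
      ← cotensorFst_apply, ← tmul_one_mul, map_mul, h1, tmul_one_mul, cotensorFst_apply]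
  -- The cotensor condition turns the coaction on `A` into `l`, so in canonical coordinates the
  -- inclusion tensored with `A` factors through `A ⊗ l`.
  have h1 : ∀ z, hA.canTensor P (BalTensor.lTensor (rightAct i) ι hιl z) =
      l.toLinearMap.lTensor A (cotensorMul l hi z) := by
    intro z
    induction z using BalTensor.induction_on with
    | zero => simp
    | add x y hx hy => simp only [map_add, hx, hy]
    | mk a x =>
      rw [BalTensor.lTensor_mk, hA.canTensor_mk, cotensorMul_mk, lTensor_mulFst, hι,
        mem_cotensor.1 x.2]
  -- Coassociativity of `ρ` turns the difference tensored with `A` into `A ⊗ (Δ ⊗ P - H ⊗ l)`.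
  have h2 : ∀ z, hA.canTensor (H ⊗[K] P) (BalTensor.lTensor (rightAct i) δ hδl z) =
      ((TensorProduct.assoc K H H P).toLinearMap ∘ₗ
        (Coalgebra.comul (R := K) (A := H)).rTensor P).lTensor A (hA.canTensor P z) -
      (l.toLinearMap.lTensor H).lTensor A (hA.canTensor P z) := by
    intro z
    induction z using BalTensor.induction_on with
    | zero => simp
    | add x y hx hy =>
      simp only [map_add, hx, hy]
      abel
    | mk a x =>
      rw [BalTensor.lTensor_mk, hA.canTensor_mk, hA.canTensor_mk, hδ, map_sub, map_sub,
        lTensor_mulFst, lTensor_mulFst, coactFst_coactFst hA.isRightCoaction, coactFst_lTensor]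
  have hSl : IsLeftAction (leftAct (cotensorBaseLeft l hi)) := isLeftAction_leftAct _
  have hinj := (hf.injective_iff hSl ((isLeftAction_leftAct i).rTensor P) ι hιl).2
    Subtype.val_injective
  have hex := (hf.exact_iff hSl ((isLeftAction_leftAct i).rTensor P)
    ((isLeftAction_leftAct i).rTensor (H ⊗[K] P)) ι δ hιl hδl).2 (cotensor_exact ρ l)
  constructor
  · intro y z hyz
    apply hinj
    apply (hA.canTensor P).injective
    rw [h1, h1]
    exact congrArg _ hyz
  · intro y
    obtain ⟨w, hw⟩ := (hA.canTensor P).surjective (l.toLinearMap.lTensor A y)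
    -- Coassociativity of `l` puts `(A ⊗ l)(y)` in the kernel of `A ⊗ (Δ ⊗ P - H ⊗ l)`, so exactness
    -- supplies a preimage. Injectivity of `A ⊗ l` then shows that it maps to `y`.
    obtain ⟨z, hz⟩ := (hex w).1 (by
      apply (hA.canTensor (H ⊗[K] P)).injective
      rw [h2, map_zero, hw, ← LinearMap.lTensor_comp_apply, ← LinearMap.lTensor_comp_apply,
        hl.coassoc, LinearMap.comp_assoc, sub_self])
    refine ⟨z, hl.lTensor_injective A ?_⟩
    rw [← h1, hz, hw]

end Cotensor


/-! ### Faithful flatness of the cotensor product over `B ⊗ D`. -/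

section Cotensor

variable {K : Type u} [CommRing K] {H : Type u} [Ring H] [HopfAlgebra K H]
  {A B P D : Type u} [Ring A] [Algebra K A] [Ring B] [Algebra K B] [Ring P] [Algebra K P]
  [Ring D] [Algebra K D]
  {i : B →ₐ[K] A} {ρ : A →ₐ[K] A ⊗[K] H} {l : P →ₐ[K] H ⊗[K] P} {j : D →ₐ[K] P}

theorem mulFst_mul_right (a : A) (x y : A ⊗[K] P) : mulFst P a (x * y) = mulFst P a x * y := by
  rw [← tmul_one_mul, ← tmul_one_mul, mul_assoc]

theorem BalTensor.hom_ext₂ {R T M N Q V : Type u} [Ring R] [Algebra K R] [Ring T] [Algebra K T]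
    [AddCommGroup M] [Module K M] [AddCommGroup N] [Module K N] [AddCommGroup Q] [Module K Q]
    [AddCommGroup V] [Module K V] {α : M →ₗ[K] R →ₗ[K] M} {γ : N →ₗ[K] T →ₗ[K] N}
    {δ : T →ₗ[K] Q →ₗ[K] Q} {β : R →ₗ[K] BalTensor γ δ →ₗ[K] BalTensor γ δ}
    {f g : BalTensor α β →ₗ[K] V}
    (h : ∀ m n q, f (BalTensor.mk α β m (BalTensor.mk γ δ n q)) =
      g (BalTensor.mk α β m (BalTensor.mk γ δ n q))) : f = g :=
  BalTensor.hom_ext fun m x =>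
    LinearMap.congr_fun (BalTensor.hom_ext (f := f ∘ₗ BalTensor.mk α β m)
      (g := g ∘ₗ BalTensor.mk α β m) (h m)) x

theorem leftAct_rightAct_comm {S R T : Type u} [Ring S] [Algebra K S] [Ring R] [Algebra K R]
    [Ring T] [Algebra K T] (f : R →ₐ[K] S) (g : T →ₐ[K] S) (r : R) (s : S) (t : T) :
    rightAct g (leftAct f r s) t = leftAct f r (rightAct g s t) := by
  simp [mul_assoc]

/-- `A ⊗_B ((A □_H P) ⊗_{B ⊗ D} N) ≅ (A ⊗ P) ⊗_{B ⊗ D} N`. -/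
def cotensorExtend (hA : IsCoalgebraGalois i ρ.toLinearMap) (hf : IsRightFaithfullyFlat i)
    (hl : IsLeftCoaction l.toLinearMap) (hj : ∀ d, l (j d) = 1 ⊗ₜ[K] j d) {N : Type u}
    [AddCommGroup N] [Module K N] (γ : B ⊗[K] D →ₗ[K] N →ₗ[K] N) :
    BalTensor (rightAct i) (BalTensor.leftActFst (β := γ)
      (α := rightAct (cotensorBase ρ l i j hA.range_eq.le hj))
      (leftAct (cotensorBaseLeft l hA.range_eq.le))
      fun b s r => (leftAct_rightAct_comm _ _ b s r).symm) ≃ₗ[K]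
    BalTensor (rightAct (Algebra.TensorProduct.map i j)) γ :=
  BalTensor.assoc (leftAct_rightAct_comm _ _) ≪≫ₗ
    BalTensor.congr (LinearEquiv.ofBijective _ (cotensorMul_bijective hA hf hl))
      (LinearEquiv.refl K N)
      (fun x r => by
        rw [LinearEquiv.ofBijective_apply, LinearEquiv.ofBijective_apply]
        induction x using BalTensor.induction_on with
        | zero => simp
        | add x y hx hy => simp only [map_add, LinearMap.add_apply, hx, hy]
        | mk a s =>
          rw [BalTensor.rightActSnd_mk, cotensorMul_mk, cotensorMul_mk, rightAct_apply,
            rightAct_apply, ← mulFst_mul_right]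
          rfl)
      (fun r n => rfl)

theorem cotensorExtend_mk (hA : IsCoalgebraGalois i ρ.toLinearMap) (hf : IsRightFaithfullyFlat i)
    (hl : IsLeftCoaction l.toLinearMap) (hj : ∀ d, l (j d) = 1 ⊗ₜ[K] j d) {N : Type u}
    [AddCommGroup N] [Module K N] (γ : B ⊗[K] D →ₗ[K] N →ₗ[K] N) (a : A) (s : cotensor ρ l)
    (n : N) : cotensorExtend hA hf hl hj γ (BalTensor.mk _ _ a (BalTensor.mk _ _ s n)) =
      BalTensor.mk _ _ (mulFst P a (s : A ⊗[K] P)) n := rfl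

section Exchange

variable {N N' : Type u} [AddCommGroup N] [Module K N] [AddCommGroup N'] [Module K N']
  {γ : B ⊗[K] D →ₗ[K] N →ₗ[K] N} {γ' : B ⊗[K] D →ₗ[K] N' →ₗ[K] N'}

/-- The images of `B` and `D` commute in `B ⊗ D`. -/
theorem IsLeftAction.comm (hγ : IsLeftAction γ) (b : B) (d : D) (n : N) :
    (γ ∘ₗ (Algebra.TensorProduct.includeLeft : B →ₐ[K] B ⊗[K] D).toLinearMap) b
      ((γ ∘ₗ (Algebra.TensorProduct.includeRight : D →ₐ[K] B ⊗[K] D).toLinearMap) d n) =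
    (γ ∘ₗ (Algebra.TensorProduct.includeRight : D →ₐ[K] B ⊗[K] D).toLinearMap) d
      ((γ ∘ₗ (Algebra.TensorProduct.includeLeft : B →ₐ[K] B ⊗[K] D).toLinearMap) b n) := by
  simp [← hγ.mul]

/-- `(A ⊗ P) ⊗_{B ⊗ D} N ≅ A ⊗_B (P ⊗_D N)` for a left `B ⊗ D`-module `N`. -/
def IsLeftAction.exchange (hγ : IsLeftAction γ) (i : B →ₐ[K] A) (j : D →ₐ[K] P) :
    BalTensor (rightAct (Algebra.TensorProduct.map i j)) γ ≃ₗ[K]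
      BalTensor (rightAct i) (BalTensor.leftActSnd (α := rightAct j) _ hγ.comm) :=
  BalTensor.exchange i j hγ.comm (fun b d n => by simp [← hγ.mul]) (fun b n => rfl)
    (fun d n => rfl)

/-- `A ⊗_B ((A □_H P) ⊗_{B ⊗ D} N) ≅ A ⊗_B (P ⊗_D N)`. -/
def cotensorExtendExchange (hA : IsCoalgebraGalois i ρ.toLinearMap) (hf : IsRightFaithfullyFlat i)
    (hl : IsLeftCoaction l.toLinearMap) (hj : ∀ d, l (j d) = 1 ⊗ₜ[K] j d) (hγ : IsLeftAction γ) :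
    BalTensor (rightAct i) (BalTensor.leftActFst (β := γ)
      (α := rightAct (cotensorBase ρ l i j hA.range_eq.le hj))
      (leftAct (cotensorBaseLeft l hA.range_eq.le))
      fun b s r => (leftAct_rightAct_comm _ _ b s r).symm) ≃ₗ[K]
    BalTensor (rightAct i) (BalTensor.leftActSnd (α := rightAct j) _ hγ.comm) :=
  cotensorExtend hA hf hl hj γ ≪≫ₗ hγ.exchange i j

/-- Naturality in the module makes these isomorphisms the rungs of a ladder, along which exactness
can be transported. -/
theorem cotensorExtendExchange_naturality (hA : IsCoalgebraGalois i ρ.toLinearMap)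
    (hf : IsRightFaithfullyFlat i) (hl : IsLeftCoaction l.toLinearMap)
    (hj : ∀ d, l (j d) = 1 ⊗ₜ[K] j d) (hγ : IsLeftAction γ) (hγ' : IsLeftAction γ')
    (g : N →ₗ[K] N') (hg : ∀ r n, g (γ r n) = γ' r (g n)) (h1 h2 h3) :
    BalTensor.lTensor (rightAct i) (BalTensor.lTensor (rightAct j) g h1) h2 ∘ₗ
      (cotensorExtendExchange hA hf hl hj hγ).toLinearMap =
    (cotensorExtendExchange hA hf hl hj hγ').toLinearMap ∘ₗ
      BalTensor.lTensor (rightAct i)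
        (BalTensor.lTensor (rightAct (cotensorBase ρ l i j hA.range_eq.le hj)) g hg) h3 := by
  refine BalTensor.hom_ext₂ fun a s n => ?_
  change BalTensor.lTensor (rightAct i) (BalTensor.lTensor (rightAct j) g h1) h2
      (hγ.exchange i j (BalTensor.mk _ _ (mulFst P a (s : A ⊗[K] P)) n)) =
    hγ'.exchange i j (BalTensor.mk _ _ (mulFst P a (s : A ⊗[K] P)) (g n))
  -- Past the first isomorphism only an element of `A ⊗ P` is left; forgetting its origin allows a
  -- reduction to elementary tensors, on which the exchange map is explicit.
  generalize mulFst P a (s : A ⊗[K] P) = u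
  induction u using TensorProduct.induction_on with
  | zero => simp only [map_zero, LinearMap.zero_apply]
  | add x y hx hy => simp only [map_add, LinearMap.add_apply, hx, hy]
  | tmul b p => rfl

end Exchange

theorem BalTensor.leftActFst_lTensor {R T : Type u} [Ring R] [Algebra K R] [Ring T] [Algebra K T]
    {M N N' : Type u} [AddCommGroup M] [Module K M] [AddCommGroup N] [Module K N] [AddCommGroup N']
    [Module K N'] {α : M →ₗ[K] R →ₗ[K] M} {β : R →ₗ[K] N →ₗ[K] N} {β' : R →ₗ[K] N' →ₗ[K] N'}
    (δ : T →ₗ[K] M →ₗ[K] M) (h : ∀ t m r, δ t (α m r) = α (δ t m) r) (g : N →ₗ[K] N')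
    (hg : ∀ r n, g (β r n) = β' r (g n)) (t : T) (x : BalTensor α β) :
    BalTensor.lTensor α g hg (BalTensor.leftActFst δ h t x) =
      BalTensor.leftActFst δ h t (BalTensor.lTensor α g hg x) := by
  induction x using BalTensor.induction_on with
  | zero => simp
  | add x y hx hy => simp only [map_add, hx, hy]
  | mk m n => simp

theorem BalTensor.leftActSnd_lTensor {R T : Type u} [Ring R] [Algebra K R] [Ring T] [Algebra K T]
    {M N N' : Type u} [AddCommGroup M] [Module K M] [AddCommGroup N] [Module K N] [AddCommGroup N']
    [Module K N'] {α : M →ₗ[K] R →ₗ[K] M} {β : R →ₗ[K] N →ₗ[K] N} {β' : R →ₗ[K] N' →ₗ[K] N'}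
    {δ : T →ₗ[K] N →ₗ[K] N} {δ' : T →ₗ[K] N' →ₗ[K] N'} (h : ∀ t r n, δ t (β r n) = β r (δ t n))
    (h' : ∀ t r n, δ' t (β' r n) = β' r (δ' t n)) (g : N →ₗ[K] N')
    (hg : ∀ r n, g (β r n) = β' r (g n)) (hδ : ∀ t n, g (δ t n) = δ' t (g n)) (t : T)
    (x : BalTensor α β) : BalTensor.lTensor α g hg (BalTensor.leftActSnd δ h t x) =
      BalTensor.leftActSnd δ' h' t (BalTensor.lTensor α g hg x) := by
  induction x using BalTensor.induction_on with
  | zero => simp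
  | add x y hx hy => simp only [map_add, hx, hy]
  | mk m n => simp [hδ]

/-- With `S = A □_H P`, exactness of a sequence `S ⊗_{B ⊗ D} N` is tested after `A ⊗_B -`, where it
becomes `A ⊗_B (P ⊗_D N)`; removing `A` and then `P` by their own faithful flatness leaves `N`. -/
theorem isRightFaithfullyFlat_cotensorBase (hA : IsCoalgebraGalois i ρ.toLinearMap)
    (hf : IsRightFaithfullyFlat i) (hg : IsRightFaithfullyFlat j)
    (hl : IsLeftCoaction l.toLinearMap) (hj : ∀ d, l (j d) = 1 ⊗ₜ[K] j d) :
    IsRightFaithfullyFlat (cotensorBase ρ l i j hA.range_eq.le hj) := by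
  intro N N' N'' _ _ _ _ _ _ _ _ _ _ _ _ g g'
  have hN : IsLeftAction (leftModAct K (B ⊗[K] D) N) := isLeftAction_leftModAct
  have hN' : IsLeftAction (leftModAct K (B ⊗[K] D) N') := isLeftAction_leftModAct
  have hN'' : IsLeftAction (leftModAct K (B ⊗[K] D) N'') := isLeftAction_leftModAct
  have e (r : B ⊗[K] D) (n : N) : (g.restrictScalars K) (leftModAct K (B ⊗[K] D) N r n) =
    leftModAct K (B ⊗[K] D) N' r (g.restrictScalars K n) := g.map_smul r n
  have e' (r : B ⊗[K] D) (n : N') : (g'.restrictScalars K) (leftModAct K (B ⊗[K] D) N' r n) =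
    leftModAct K (B ⊗[K] D) N'' r (g'.restrictScalars K n) := g'.map_smul r n
  have hS := isLeftAction_leftAct (cotensorBaseLeft l hA.range_eq.le)
  have hc (b : B) (s : cotensor ρ l) (r : B ⊗[K] D) :=
    (leftAct_rightAct_comm (cotensorBaseLeft l hA.range_eq.le)
      (cotensorBase ρ l i j hA.range_eq.le hj) b s r).symm
  have hL := (hN.comp Algebra.TensorProduct.includeLeft).leftActSnd (α := rightAct j) hN.comm
  have hL' := (hN'.comp Algebra.TensorProduct.includeLeft).leftActSnd (α := rightAct j) hN'.comm
  have hL'' := (hN''.comp Algebra.TensorProduct.includeLeft).leftActSnd (α := rightAct j) hN''.comm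
  refine (hf.exact_iff (hS.leftActFst hc) (hS.leftActFst hc) (hS.leftActFst hc) _ _
    (BalTensor.leftActFst_lTensor _ hc _ e) (BalTensor.leftActFst_lTensor _ hc _ e')).symm.trans ?_
  refine Iff.trans ?_ (hg.exact_iff (hN.comp Algebra.TensorProduct.includeRight)
    (hN'.comp Algebra.TensorProduct.includeRight) (hN''.comp Algebra.TensorProduct.includeRight)
    _ _ (fun d n => e _ n) (fun d n => e' _ n))
  refine Iff.trans ?_ (hf.exact_iff hL hL' hL'' _ _
    (BalTensor.leftActSnd_lTensor hN.comm hN'.comm _ _ fun b n => e _ n)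
    (BalTensor.leftActSnd_lTensor hN'.comm hN''.comm _ _ fun b n => e' _ n))
  exact (Function.Exact.iff_of_ladder_linearEquiv
    (cotensorExtendExchange_naturality hA hf hl hj hN hN' _ e _ _ _)
    (cotensorExtendExchange_naturality hA hf hl hj hN' hN'' _ e' _ _ _)).symm

end Cotensor


/-! ### The coaction on the cotensor product. -/

section Cotensor

variable {K : Type u} [CommRing K] {H : Type u} [Ring H] [HopfAlgebra K H]
  {C : Type u} [AddCommGroup C] [Module K C]
  {A B P D : Type u} [Ring A] [Algebra K A] [Ring B] [Algebra K B] [Ring P] [Algebra K P]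
  [Ring D] [Algebra K D]
  {i : B →ₐ[K] A} {ρ : A →ₐ[K] A ⊗[K] H} {l : P →ₐ[K] H ⊗[K] P} {j : D →ₐ[K] P}
  {ρC : P →ₗ[K] P ⊗[K] C}

theorem tensorCoaction_tmul (a : A) (p : P) :
    tensorCoaction A ρC (a ⊗ₜ[K] p) = (TensorProduct.assoc K A P C).symm (a ⊗ₜ[K] ρC p) := rfl

theorem mulFst_tmul_assoc_symm (a b : A) (p : P) (x : P ⊗[K] C) :
    mulFst C (a ⊗ₜ[K] p) ((TensorProduct.assoc K A P C).symm (b ⊗ₜ[K] x)) =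
      (TensorProduct.assoc K A P C).symm ((a * b) ⊗ₜ[K] mulFst C p x) := by
  induction x using TensorProduct.induction_on with
  | zero => simp
  | tmul q c => simp
  | add x y hx hy => simp only [TensorProduct.tmul_add, map_add, hx, hy]

/-- The coaction does not touch the factor `A`, so any algebra map into `A` is allowed and only the
coinvariance of `D` matters. -/
theorem map_range_le_coinv (i : B →ₐ[K] A) (hj : j.range ≤ coinv ρC) :
    (Algebra.TensorProduct.map i j).range ≤ coinv (tensorCoaction A ρC) := by
  rintro _ ⟨r, rfl⟩
  change Algebra.TensorProduct.map i j r ∈ _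
  induction r using TensorProduct.induction_on with
  | zero => rw [map_zero]; exact zero_mem _
  | add x y hx hy => rw [map_add]; exact add_mem hx hy
  | tmul b d =>
    intro q
    rw [Algebra.TensorProduct.map_tmul]
    induction q using TensorProduct.induction_on with
    | zero => simp
    | add x y hx hy => simp only [mul_add, map_add, hx, hy]
    | tmul a p =>
      rw [Algebra.TensorProduct.tmul_mul_tmul, tensorCoaction_tmul, tensorCoaction_tmul,
        mulFst_tmul_assoc_symm]
      exact congrArg _ (congrArg _ (mem_coinv.1 (hj ⟨d, rfl⟩) p))

theorem cotensorTensorIncl_mulFst (s : cotensor ρ l) (x : cotensor ρ l ⊗[K] C) :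
    cotensorTensorIncl ρ l C (mulFst C s x) =
      mulFst C (s : A ⊗[K] P) (cotensorTensorIncl ρ l C x) := by
  induction x using TensorProduct.induction_on with
  | zero => simp
  | tmul q c => rfl
  | add x y hx hy => simp only [map_add, hx, hy]

theorem IsRightCoaction.tensorCoaction [Coalgebra K C] (hρ : IsRightCoaction ρC) :
    IsRightCoaction (tensorCoaction A ρC) where
  coassoc := by
    refine TensorProduct.ext' fun a p => ?_
    have h1 (x : P ⊗[K] C) : TensorProduct.assoc K (A ⊗[K] P) C C
        ((CotensorGalois.tensorCoaction A ρC).rTensor C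
          ((TensorProduct.assoc K A P C).symm (a ⊗ₜ[K] x))) =
        (TensorProduct.assoc K A P (C ⊗[K] C)).symm
          (a ⊗ₜ[K] TensorProduct.assoc K P C C (ρC.rTensor C x)) := by
      induction x using TensorProduct.induction_on with
      | zero => simp
      | add x y hx hy => simp only [TensorProduct.tmul_add, map_add, hx, hy]
      | tmul q c =>
        simp only [TensorProduct.assoc_symm_tmul, LinearMap.rTensor_tmul, tensorCoaction_tmul]
        induction ρC q using TensorProduct.induction_on with
        | zero => simp
        | add x y hx hy =>
          simp only [TensorProduct.tmul_add, TensorProduct.add_tmul, map_add, hx, hy]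
        | tmul q c => simp
    have h2 (x : P ⊗[K] C) : (Coalgebra.comul (R := K) (A := C)).lTensor (A ⊗[K] P)
        ((TensorProduct.assoc K A P C).symm (a ⊗ₜ[K] x)) =
        (TensorProduct.assoc K A P (C ⊗[K] C)).symm
          (a ⊗ₜ[K] (Coalgebra.comul (R := K) (A := C)).lTensor P x) := by
      induction x using TensorProduct.induction_on with
      | zero => simp
      | add x y hx hy => simp only [TensorProduct.tmul_add, map_add, hx, hy]
      | tmul q c =>
        simp only [TensorProduct.assoc_symm_tmul, LinearMap.lTensor_tmul]
    have := LinearMap.congr_fun hρ.coassoc p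
    simp only [LinearMap.comp_apply, LinearEquiv.coe_coe] at this ⊢
    rw [tensorCoaction_tmul, h1, h2, this]
  counit := by
    refine TensorProduct.ext' fun a p => ?_
    have h1 (x : P ⊗[K] C) : TensorProduct.rid K (A ⊗[K] P)
        ((Coalgebra.counit (R := K) (A := C)).lTensor (A ⊗[K] P)
          ((TensorProduct.assoc K A P C).symm (a ⊗ₜ[K] x))) =
        a ⊗ₜ[K] TensorProduct.rid K P ((Coalgebra.counit (R := K) (A := C)).lTensor P x) := by
      induction x using TensorProduct.induction_on with
      | zero => simp
      | add x y hx hy => simp only [TensorProduct.tmul_add, map_add, hx, hy]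
      | tmul q c => simp
    have := LinearMap.congr_fun hρ.counit p
    simp only [LinearMap.comp_apply, LinearEquiv.coe_coe, LinearMap.id_apply] at this ⊢
    rw [tensorCoaction_tmul, h1, this]

variable [Module.Flat K C]

theorem cotensorBase_range_le_coinv (hb : IsBicomodule l.toLinearMap ρC)
    (hi : i.range ≤ coinv ρ.toLinearMap) (hj : ∀ d, l (j d) = 1 ⊗ₜ[K] j d)
    (hjC : j.range ≤ coinv ρC) :
    (cotensorBase ρ l i j hi hj).range ≤ coinv (cotensorCoaction ρ l ρC hb) := by
  rintro _ ⟨r, rfl⟩ q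
  apply cotensorTensorIncl_injective ρ l
  rw [cotensorCoaction_spec, cotensorTensorIncl_mulFst, cotensorCoaction_spec]
  exact mem_coinv.1 (map_range_le_coinv i hjC ⟨r, rfl⟩) q

/-- Both axioms are inherited from `A ⊗ P` by comparison along injective inclusions. -/
theorem isRightCoaction_cotensorCoaction [Coalgebra K C] (hb : IsBicomodule l.toLinearMap ρC)
    (hρ : IsRightCoaction ρC) : IsRightCoaction (cotensorCoaction ρ l ρC hb) where
  coassoc := by
    refine LinearMap.ext fun q => ?_
    -- Coassociativity takes values in `(A □_H P) ⊗ C ⊗ C`, so flatness is needed for `C ⊗ C`, which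
    -- inherits it from `C`.
    have hinj : Function.Injective (cotensorTensorIncl ρ l (C ⊗[K] C)) :=
      cotensorTensorIncl_injective ρ l
    apply hinj
    have h1 (x : cotensor ρ l ⊗[K] C) : cotensorTensorIncl ρ l (C ⊗[K] C)
        (TensorProduct.assoc K _ C C ((cotensorCoaction ρ l ρC hb).rTensor C x)) =
        TensorProduct.assoc K _ C C
          ((tensorCoaction A ρC).rTensor C (cotensorTensorIncl ρ l C x)) := by
      induction x using TensorProduct.induction_on with
      | zero => simp
      | add x y hx hy => simp only [map_add, hx, hy]
      | tmul s c =>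
        have h3 : cotensorTensorIncl ρ l C (s ⊗ₜ[K] c) = (s : A ⊗[K] P) ⊗ₜ[K] c := rfl
        rw [h3, LinearMap.rTensor_tmul, LinearMap.rTensor_tmul, ← cotensorCoaction_spec ρ l ρC hb]
        induction cotensorCoaction ρ l ρC hb s using TensorProduct.induction_on with
        | zero => simp
        | add x y hx hy => simp only [TensorProduct.add_tmul, map_add, hx, hy]
        | tmul s c => rfl
    have h2 (x : cotensor ρ l ⊗[K] C) : cotensorTensorIncl ρ l (C ⊗[K] C)
        ((Coalgebra.comul (R := K) (A := C)).lTensor _ x) =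
        (Coalgebra.comul (R := K) (A := C)).lTensor _ (cotensorTensorIncl ρ l C x) := by
      induction x using TensorProduct.induction_on with
      | zero => simp
      | add x y hx hy => simp only [map_add, hx, hy]
      | tmul s c => rfl
    have := LinearMap.congr_fun (hρ.tensorCoaction (A := A)).coassoc (q : A ⊗[K] P)
    simp only [LinearMap.comp_apply, LinearEquiv.coe_coe] at this ⊢
    rw [h1, h2, cotensorCoaction_spec, this]
  counit := by
    refine LinearMap.ext fun q => Subtype.ext ?_
    have h1 (x : cotensor ρ l ⊗[K] C) : ((TensorProduct.rid K _
        ((Coalgebra.counit (R := K) (A := C)).lTensor _ x) : cotensor ρ l) : A ⊗[K] P) =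
        TensorProduct.rid K _
          ((Coalgebra.counit (R := K) (A := C)).lTensor _ (cotensorTensorIncl ρ l C x)) := by
      induction x using TensorProduct.induction_on with
      | zero => simp
      | add x y hx hy => simp only [map_add, Subalgebra.coe_add, hx, hy]
      | tmul s c => rfl
    have := LinearMap.congr_fun (hρ.tensorCoaction (A := A)).counit (q : A ⊗[K] P)
    simp only [LinearMap.comp_apply, LinearEquiv.coe_coe, LinearMap.id_apply] at this ⊢
    rw [h1, cotensorCoaction_spec, this]

end Cotensor


/-! ### Bijectivity of the canonical map of the cotensor product. -/

section Cotensor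

variable {K : Type u} [CommRing K] {H : Type u} [Ring H] [HopfAlgebra K H]
  {C : Type u} [AddCommGroup C] [Module K C]
  {A B P D : Type u} [Ring A] [Algebra K A] [Ring B] [Algebra K B] [Ring P] [Algebra K P]
  [Ring D] [Algebra K D]
  {i : B →ₐ[K] A} {ρ : A →ₐ[K] A ⊗[K] H} {l : P →ₐ[K] H ⊗[K] P} {j : D →ₐ[K] P}
  {ρC : P →ₗ[K] P ⊗[K] C}

/-- The isomorphism `A ⊗_B ((A □_H P) ⊗ C) ≅ A ⊗ (P ⊗ C)`. -/
def cotensorMulTensor (hA : IsCoalgebraGalois i ρ.toLinearMap) (hf : IsRightFaithfullyFlat i)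
    (hl : IsLeftCoaction l.toLinearMap) (C : Type u) [AddCommGroup C] [Module K C] :
    BalTensor (N := cotensor ρ l ⊗[K] C) (rightAct i)
      (LinearMap.rTensorHom C ∘ₗ leftAct (cotensorBaseLeft l hA.range_eq.le)) ≃ₗ[K]
      A ⊗[K] (P ⊗[K] C) :=
  BalTensor.tensorRight _ _ C ≪≫ₗ
    LinearEquiv.rTensor C (LinearEquiv.ofBijective _ (cotensorMul_bijective hA hf hl)) ≪≫ₗ
    TensorProduct.assoc K A P C

theorem cotensorMulTensor_mk (hA : IsCoalgebraGalois i ρ.toLinearMap)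
    (hf : IsRightFaithfullyFlat i) (hl : IsLeftCoaction l.toLinearMap) (a : A)
    (x : cotensor ρ l ⊗[K] C) : cotensorMulTensor hA hf hl C (BalTensor.mk _ _ a x) =
      TensorProduct.assoc K A P C (mulFst C (a ⊗ₜ[K] 1) (cotensorTensorIncl ρ l C x)) := by
  induction x using TensorProduct.induction_on with
  | zero => simp
  | add x y hx hy => simp only [map_add, hx, hy]
  | tmul s c =>
    have h : cotensorTensorIncl ρ l C (s ⊗ₜ[K] c) = (s : A ⊗[K] P) ⊗ₜ[K] c := rfl
    rw [h, mulFst_tmul, tmul_one_mul]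
    rfl

/-- The canonical map of `A ⊗ P` restricts to that of `A □_H P`. The restriction is injective, and
so is the inclusion of targets by flatness of `C`; hence so is the inclusion of sources. -/
theorem cotensorExtIncl_injective [Module.Flat K C] (hi : i.range ≤ coinv ρ.toLinearMap)
    (hjC : j.range ≤ coinv ρC) (hj : ∀ d, l (j d) = 1 ⊗ₜ[K] j d)
    (hb : IsBicomodule l.toLinearMap ρC) (h)
    (hc : Function.Injective
      (can (cotensorBase ρ l i j hi hj) (cotensorCoaction ρ l ρC hb) h)) :
    Function.Injective (cotensorExtIncl ρ l i j hi hj) := by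
  have key : ∀ z, can _ (tensorCoaction A ρC) (map_range_le_coinv i hjC)
      (cotensorExtIncl ρ l i j hi hj z) =
      cotensorTensorIncl ρ l C (can _ (cotensorCoaction ρ l ρC hb) h z) := by
    intro z
    induction z using BalTensor.induction_on with
    | zero => simp only [map_zero]
    | add x y hx hy => simp only [map_add, hx, hy]
    | mk s t =>
      rw [can_mk, cotensorTensorIncl_mulFst, cotensorCoaction_spec]
      exact can_mk _ _ _ _ _
  intro y z hyz
  apply hc
  apply cotensorTensorIncl_injective ρ l
  rw [← key, ← key, hyz]

variable [Coalgebra K C]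

/-- The isomorphism `P ⊗_D (A ⊗ P) ≅ A ⊗ (P ⊗ C)` induced by the canonical map of `P`. -/
def IsCoalgebraGalois.canTensorLeft (hP : IsCoalgebraGalois j ρC) (A : Type u) [Ring A]
    [Algebra K A] : BalTensor (rightAct j) (LinearMap.lTensorHom A ∘ₗ leftAct j) ≃ₗ[K]
      A ⊗[K] (P ⊗[K] C) :=
  BalTensor.tensorLeft (rightAct j) (leftAct j) A ≪≫ₗ LinearEquiv.lTensor A hP.canEquiv

/-- In `P ⊗_D (A ⊗ P)` the factor `A` sits inside the second entry, so `a` multiplies there while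
`p` stays in the first. Together they act as `a ⊗ p` on the target. -/
theorem IsCoalgebraGalois.canTensorLeft_mk (hP : IsCoalgebraGalois j ρC) (a : A) (p : P)
    (x : A ⊗[K] P) : hP.canTensorLeft A (BalTensor.mk _ _ p (mulFst P a x)) =
      TensorProduct.assoc K A P C (mulFst C (a ⊗ₜ[K] p) (tensorCoaction A ρC x)) := by
  induction x using TensorProduct.induction_on with
  | zero => simp
  | add x y hx hy => simp only [map_add, hx, hy]
  | tmul b q =>
    rw [tensorCoaction_tmul, mulFst_tmul_assoc_symm, LinearEquiv.apply_symm_apply, mulFst_tmul,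
      ← can_mk j ρC hP.range_eq.le]
    rfl

theorem mulFst_one_tmul_mul (a : A) (p : P) (x : A ⊗[K] P) :
    mulFst P a ((1 ⊗ₜ[K] p) * x) = (LinearMap.mulLeft K p).lTensor A (mulFst P a x) := by
  induction x using TensorProduct.induction_on with
  | zero => simp
  | tmul b q => simp
  | add x y hx hy => simp only [mul_add, map_add, hx, hy]

theorem leftAct_cotensorBase_comm (hi : i.range ≤ coinv ρ.toLinearMap)
    (hj : ∀ d, l (j d) = 1 ⊗ₜ[K] j d) (b : B) (d : D) (s : cotensor ρ l) :
    leftAct (cotensorBaseLeft l hi) b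
      (leftAct ((cotensorBase ρ l i j hi hj).comp Algebra.TensorProduct.includeRight) d s) =
    leftAct ((cotensorBase ρ l i j hi hj).comp Algebra.TensorProduct.includeRight) d
      (leftAct (cotensorBaseLeft l hi) b s) := by
  rw [leftAct_apply, leftAct_apply, leftAct_apply, leftAct_apply,
    ← cotensorBase_tmul_one hi j hj, AlgHom.comp_apply, ← mul_assoc, ← mul_assoc, ← map_mul,
    ← map_mul]
  simp

/-- `(A ⊗ P) ⊗_{B ⊗ D} (A □_H P) ≅ A ⊗ (P ⊗ C)`, through `P ⊗_D (A ⊗_B (A □_H P))`. -/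
def cotensorExtendCan (hA : IsCoalgebraGalois i ρ.toLinearMap) (hf : IsRightFaithfullyFlat i)
    (hl : IsLeftCoaction l.toLinearMap) (hP : IsCoalgebraGalois j ρC)
    (hj : ∀ d, l (j d) = 1 ⊗ₜ[K] j d) :
    BalTensor (rightAct (Algebra.TensorProduct.map i j))
      (leftAct (cotensorBase ρ l i j hA.range_eq.le hj)) ≃ₗ[K] A ⊗[K] (P ⊗[K] C) :=
  BalTensor.exchange i j (leftAct_cotensorBase_comm hA.range_eq.le hj)
    (fun b d s => by
      rw [leftAct_apply, leftAct_apply, leftAct_apply, ← cotensorBase_tmul_one _ j hj,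
        AlgHom.comp_apply, ← mul_assoc, ← map_mul]
      simp)
    (fun b s => by rw [leftAct_apply, leftAct_apply, cotensorBase_tmul_one])
    (fun d s => rfl) ≪≫ₗ
  BalTensor.swap _ _ (leftAct_cotensorBase_comm hA.range_eq.le hj) ≪≫ₗ
  BalTensor.congr (LinearEquiv.refl K P)
    (LinearEquiv.ofBijective _ (cotensorMul_bijective hA hf hl)) (fun _ _ => rfl)
    (fun d x => by
      rw [LinearEquiv.ofBijective_apply, LinearEquiv.ofBijective_apply]
      induction x using BalTensor.induction_on with
      | zero => simp
      | add x y hx hy => simp only [map_add, hx, hy]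
      | mk a s =>
        have h : ((leftAct ((cotensorBase ρ l i j hA.range_eq.le hj).comp
            Algebra.TensorProduct.includeRight) d s : cotensor ρ l) : A ⊗[K] P) =
            (1 ⊗ₜ[K] j d) * (s : A ⊗[K] P) := by simp
        rw [BalTensor.leftActSnd_mk, cotensorMul_mk, cotensorMul_mk, h]
        exact mulFst_one_tmul_mul a (j d) (s : A ⊗[K] P)) ≪≫ₗ
  hP.canTensorLeft A

/-- The chain of interchanges yields the canonical formula `x ⊗ s ↦ x ρ(s)`, with first entry
anywhere in `A ⊗ P`. -/
theorem cotensorExtendCan_mk (hA : IsCoalgebraGalois i ρ.toLinearMap)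
    (hf : IsRightFaithfullyFlat i) (hl : IsLeftCoaction l.toLinearMap)
    (hP : IsCoalgebraGalois j ρC) (hj : ∀ d, l (j d) = 1 ⊗ₜ[K] j d) (x : A ⊗[K] P)
    (s : cotensor ρ l) : cotensorExtendCan hA hf hl hP hj (BalTensor.mk _ _ x s) =
      TensorProduct.assoc K A P C
        (mulFst C x (tensorCoaction A ρC (s : A ⊗[K] P))) := by
  induction x using TensorProduct.induction_on with
  | zero => rw [← mulFstHom_apply, map_zero, map_zero, LinearMap.zero_apply, LinearMap.zero_apply,
      map_zero, map_zero]
  | add x y hx hy => rw [map_add, LinearMap.add_apply, map_add, hx, hy, mulFst_add, map_add]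
  | tmul a p => exact hP.canTensorLeft_mk a p s

/-- Since `A` is faithfully flat over `B`, bijectivity may be checked after `A ⊗_B -`. There the map
is identified with a composite of isomorphisms, the last of which comes from the canonical map of
`P`. -/
theorem can_cotensor_bijective [Module.Flat K C] (hA : IsCoalgebraGalois i ρ.toLinearMap)
    (hf : IsRightFaithfullyFlat i) (hl : IsLeftCoaction l.toLinearMap)
    (hP : IsCoalgebraGalois j ρC) (hj : ∀ d, l (j d) = 1 ⊗ₜ[K] j d)
    (hb : IsBicomodule l.toLinearMap ρC) :
    Function.Bijective (can (cotensorBase ρ l i j hA.range_eq.le hj) (cotensorCoaction ρ l ρC hb)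
      (cotensorBase_range_le_coinv hb hA.range_eq.le hj hP.range_eq.le)) := by
  have hr := cotensorBase_range_le_coinv hb hA.range_eq.le hj hP.range_eq.le
  have hS := isLeftAction_leftAct (cotensorBaseLeft l hA.range_eq.le)
  have hc (b : B) (s : cotensor ρ l) (r : B ⊗[K] D) :=
    (leftAct_rightAct_comm (cotensorBaseLeft l hA.range_eq.le)
      (cotensorBase ρ l i j hA.range_eq.le hj) b s r).symm
  have hlin (b : B) (z : ExtTensor (cotensorBase ρ l i j hA.range_eq.le hj)) :
      can _ (cotensorCoaction ρ l ρC hb) hr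
        (BalTensor.leftActFst (leftAct (cotensorBaseLeft l hA.range_eq.le)) hc b z) =
      (LinearMap.rTensorHom C ∘ₗ leftAct (cotensorBaseLeft l hA.range_eq.le)) b
        (can _ (cotensorCoaction ρ l ρC hb) hr z) := by
    induction z using BalTensor.induction_on with
    | zero => simp only [map_zero]
    | add x y hx hy => simp only [map_add, hx, hy]
    | mk s t =>
      rw [BalTensor.leftActFst_mk, can_mk, can_mk, leftAct_apply, mulFst_mul,
        rTensorHom_leftAct_apply]
  rw [← hf.bijective_iff (hS.leftActFst hc) (hS.rTensor C) _ hlin]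
  -- Both routes send `a ⊗ (s ⊗ t)` to `(a ⊗ 1) s ρ(t)`.
  have key : (cotensorMulTensor hA hf hl C).toLinearMap ∘ₗ
      BalTensor.lTensor (N' := cotensor ρ l ⊗[K] C) (rightAct i)
        (can _ (cotensorCoaction ρ l ρC hb) hr) hlin =
      (cotensorExtend hA hf hl hj _ ≪≫ₗ cotensorExtendCan hA hf hl hP hj).toLinearMap := by
    refine BalTensor.hom_ext₂ fun a s t => ?_
    simp only [LinearMap.comp_apply, LinearEquiv.coe_coe, BalTensor.lTensor_mk,
      LinearEquiv.trans_apply, cotensorExtend_mk, cotensorExtendCan_mk, cotensorMulTensor_mk,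
      can_mk, cotensorTensorIncl_mulFst, cotensorCoaction_spec]
    rw [← mulFst_mul, tmul_one_mul]
  have := (cotensorExtend hA hf hl hj _ ≪≫ₗ cotensorExtendCan hA hf hl hP hj).bijective
  rw [← LinearEquiv.coe_toLinearMap, ← key, LinearMap.coe_comp] at this
  exact (Function.Bijective.of_comp_iff' (cotensorMulTensor hA hf hl C).bijective _).1 this

/-- Faithful flatness and bijectivity of the canonical map are established first; injectivity of the
base map and the determination of the coinvariants follow from them by descent. -/
theorem isCoalgebraGalois_cotensor [Module.Flat K C] (hA : IsCoalgebraGalois i ρ.toLinearMap)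
    (hf : IsRightFaithfullyFlat i) (hg : IsRightFaithfullyFlat j)
    (hl : IsLeftCoaction l.toLinearMap) (hP : IsCoalgebraGalois j ρC)
    (hj : ∀ d, l (j d) = 1 ⊗ₜ[K] j d) (hb : IsBicomodule l.toLinearMap ρC) :
    IsCoalgebraGalois (cotensorBase ρ l i j hA.range_eq.le hj) (cotensorCoaction ρ l ρC hb) := by
  have hff := isRightFaithfullyFlat_cotensorBase hA hf hg hl hj
  have hcan := can_cotensor_bijective hA hf hl hP hj hb
  exact ⟨isRightCoaction_cotensorCoaction hb hP.isRightCoaction, hff.injective,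
    hff.range_eq_coinv _ hcan.injective, hcan⟩

end Cotensor


/-! ### The explicit inverse of the canonical map. -/

section Formula

variable {K : Type u} [CommRing K] {H : Type u} [Ring H] [HopfAlgebra K H]
  {C : Type u} [AddCommGroup C] [Module K C] [Coalgebra K C]
  {A B P D : Type u} [Ring A] [Algebra K A] [Ring B] [Algebra K B] [Ring P] [Algebra K P]
  [Ring D] [Algebra K D]
  {i : B →ₐ[K] A} {ρ : A →ₐ[K] A ⊗[K] H} {l : P →ₐ[K] H ⊗[K] P} {j : D →ₐ[K] P}
  {ρC : P →ₗ[K] P ⊗[K] C}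

@[simp] theorem extMulLeft_mk {f : D →ₐ[K] P} (p q r : P) :
    extMulLeft f p (BalTensor.mk _ _ q r) = BalTensor.mk _ _ (p * q) r := rfl

theorem extMulLeft_mul {f : D →ₐ[K] P} (p q : P) (z : ExtTensor f) :
    extMulLeft f (p * q) z = extMulLeft f p (extMulLeft f q z) := by
  induction z using BalTensor.induction_on with
  | zero => simp
  | mk r s => simp [mul_assoc]
  | add x y hx hy => simp only [map_add, hx, hy]

theorem extMulLeft_add {f : D →ₐ[K] P} (p q : P) (z : ExtTensor f) :
    extMulLeft f (p + q) z = extMulLeft f p z + extMulLeft f q z := by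
  induction z using BalTensor.induction_on with
  | zero => simp
  | mk r s => simp [add_mul]
  | add x y hx hy => simp only [map_add, hx, hy]; abel

theorem extMulLeft_smul {f : D →ₐ[K] P} (k : K) (p : P) (z : ExtTensor f) :
    extMulLeft f (k • p) z = k • extMulLeft f p z := by
  induction z using BalTensor.induction_on with
  | zero => simp
  | mk r s => simp
  | add x y hx hy => simp only [map_add, smul_add, hx, hy]

/-- `extMulLeft` as a bilinear map. -/
def extMulLeftHom (f : D →ₐ[K] P) : P →ₗ[K] ExtTensor f →ₗ[K] ExtTensor f where
  toFun := extMulLeft f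
  map_add' p q := LinearMap.ext (extMulLeft_add p q)
  map_smul' k p := LinearMap.ext (extMulLeft_smul k p)

@[simp] theorem extMulLeftHom_apply (f : D →ₐ[K] P) (p : P) (z : ExtTensor f) :
    extMulLeftHom f p z = extMulLeft f p z := rfl

/-- The canonical map is left `P`-linear, so its inverse is determined by the translation map. -/
theorem IsCoalgebraGalois.canEquiv_symm_tmul (hP : IsCoalgebraGalois j ρC) (p : P) (c : C) :
    hP.canEquiv.symm (p ⊗ₜ[K] c) = extMulLeft j p (hP.translation c) := by
  rw [LinearEquiv.symm_apply_eq]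
  have h (z : ExtTensor j) : hP.canEquiv (extMulLeft j p z) = mulFst C p (hP.canEquiv z) := by
    induction z using BalTensor.induction_on with
    | zero => simp
    | mk r s => exact can_mul_left j ρC hP.range_eq.le p r s
    | add x y hx hy => simp only [map_add, hx, hy]
  rw [h, IsCoalgebraGalois.translation, LinearMap.comp_apply, LinearEquiv.coe_coe,
    LinearEquiv.apply_symm_apply, TensorProduct.mk_apply, mulFst_tmul, mul_one]

theorem shuffle_extMulLeft (a : A) (p : P) (y : ExtTensor i) (z : ExtTensor j) :
    shuffle i j (extMulLeft i a y) (extMulLeft j p z) =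
      extMulLeft _ (a ⊗ₜ[K] p) (shuffle i j y z) := by
  induction y using BalTensor.induction_on with
  | zero => simp
  | add x y hx hy => simp only [map_add, LinearMap.add_apply, hx, hy]
  | mk a b =>
    induction z using BalTensor.induction_on with
    | zero => simp
    | add x y hx hy => simp only [map_add, hx, hy]
    | mk p q =>
      rw [extMulLeft_mk, extMulLeft_mk, shuffle_mk, shuffle_mk, extMulLeft_mk,
        Algebra.TensorProduct.tmul_mul_tmul]

theorem extMulLeft_one {f : D →ₐ[K] P} (z : ExtTensor f) : extMulLeft f 1 z = z := by
  induction z using BalTensor.induction_on with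
  | zero => simp
  | mk r s => simp
  | add x y hx hy => simp only [map_add, hx, hy]

/-- A form of `twist_mk` that is linear in `l v` and refers to no chosen decomposition, so that
tensor induction on `l v` applies. -/
theorem twist_mk_eq (hj : ∀ d, l (j d) = 1 ⊗ₜ[K] j d) (τ : H →ₗ[K] ExtTensor i) (u v : P) :
    twist l i j hj τ (BalTensor.mk _ _ u v) =
      TensorProduct.lift ((shuffle i j ∘ₗ τ).compl₂ (BalTensor.mk (rightAct j) (leftAct j) u))
        (l v) := by
  obtain ⟨s, h⟩ := TensorProduct.exists_finset (l v)
  rw [twist_mk l i j hj τ u v s _ _ h, h, map_sum]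
  rfl

theorem twist_extMulLeft (hj : ∀ d, l (j d) = 1 ⊗ₜ[K] j d) (τ : H →ₗ[K] ExtTensor i) (p : P)
    (z : ExtTensor j) :
    twist l i j hj τ (extMulLeft j p z) = extMulLeft _ (1 ⊗ₜ[K] p) (twist l i j hj τ z) := by
  induction z using BalTensor.induction_on with
  | zero => simp
  | add x y hx hy => simp only [map_add, hx, hy]
  | mk u v =>
    rw [extMulLeft_mk, twist_mk_eq, twist_mk_eq]
    induction l v using TensorProduct.induction_on with
    | zero => simp
    | add x y hx hy => simp only [map_add, hx, hy]
    | tmul h w =>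
      simp only [TensorProduct.lift.tmul, LinearMap.compl₂_apply, LinearMap.comp_apply]
      rw [← extMulLeft_mk, ← shuffle_extMulLeft, extMulLeft_one]

/-- The map `A ⊗ (P ⊗_D P) → (A ⊗ P) ⊗_{B ⊗ D} (A ⊗ P)`, `a ⊗ z ↦ (a ⊗ 1) twist z`. -/
def tensorTwist (hj : ∀ d, l (j d) = 1 ⊗ₜ[K] j d) (τ : H →ₗ[K] ExtTensor i) :
    A ⊗[K] ExtTensor j →ₗ[K] ExtTensor (Algebra.TensorProduct.map i j) :=
  TensorProduct.lift ((extMulLeftHom (Algebra.TensorProduct.map i j) ∘ₗ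
    (TensorProduct.mk K A P).flip 1).compl₂ (twist l i j hj τ))

theorem tensorTwist_tmul (hj : ∀ d, l (j d) = 1 ⊗ₜ[K] j d) (τ : H →ₗ[K] ExtTensor i) (a : A)
    (z : ExtTensor j) : tensorTwist hj τ (a ⊗ₜ[K] z) =
      extMulLeft _ (a ⊗ₜ[K] 1) (twist l i j hj τ z) := rfl

/-- The map `A ⊗ (H ⊗ P) → (A ⊗ P) ⊗_{B ⊗ D} (A ⊗ P)`,
`a ⊗ (h ⊗ v) ↦ (a h^[1] ⊗ u) ⊗_{B ⊗ D} (h^[2] ⊗ v)`. -/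
def translationShuffle (hA : IsCoalgebraGalois i ρ.toLinearMap) (j : D →ₐ[K] P) (u : P) :
    A ⊗[K] (H ⊗[K] P) →ₗ[K] ExtTensor (Algebra.TensorProduct.map i j) :=
  TensorProduct.lift ((shuffle i j).compl₂ (BalTensor.mk (rightAct j) (leftAct j) u)) ∘ₗ
    hA.canEquiv.symm.toLinearMap.rTensor P ∘ₗ (TensorProduct.assoc K A H P).symm.toLinearMap

/-- This is the identity `a_(0) a_(1)^[1] ⊗_B a_(1)^[2] = 1 ⊗_B a`, which holds because the
canonical map sends `1 ⊗_B a` to `ρ(a)`. -/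
theorem translationShuffle_coactFst (hA : IsCoalgebraGalois i ρ.toLinearMap) (u : P)
    (x : A ⊗[K] P) : translationShuffle hA j u (coactFst ρ P x) =
      BalTensor.mk _ _ (1 ⊗ₜ[K] u) x := by
  induction x using TensorProduct.induction_on with
  | zero => simp
  | add x y hx hy => simp only [map_add, hx, hy]
  | tmul a v =>
    have h : hA.canEquiv.symm (ρ a) = BalTensor.mk _ _ 1 a := by
      rw [LinearEquiv.symm_apply_eq]
      exact ((can_mk i ρ.toLinearMap hA.range_eq.le 1 a).trans (mulFst_one _)).symm
    rw [coactFst_tmul, translationShuffle, LinearMap.comp_apply, LinearMap.comp_apply,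
      LinearEquiv.coe_coe, LinearEquiv.symm_apply_apply, LinearMap.rTensor_tmul,
      LinearEquiv.coe_coe, h]
    rfl

/-- The same map evaluated on the other leg of the equaliser: inserting `l` instead of `ρ` produces
the twisted expression of the formula. On `A □_H P` the two evaluations coincide. -/
theorem translationShuffle_lTensor (hA : IsCoalgebraGalois i ρ.toLinearMap)
    (hj : ∀ d, l (j d) = 1 ⊗ₜ[K] j d) (u : P) (x : A ⊗[K] P) :
    translationShuffle hA j u (l.toLinearMap.lTensor A x) =
      tensorTwist hj hA.translation
        ((BalTensor.mk (rightAct j) (leftAct j) u).lTensor A x) := by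
  induction x using TensorProduct.induction_on with
  | zero => simp
  | add x y hx hy => simp only [map_add, hx, hy]
  | tmul a v =>
    rw [LinearMap.lTensor_tmul, LinearMap.lTensor_tmul, tensorTwist_tmul, twist_mk_eq,
      AlgHom.toLinearMap_apply]
    induction l v using TensorProduct.induction_on with
    | zero => simp
    | add x y hx hy => simp only [TensorProduct.tmul_add, map_add, hx, hy]
    | tmul h w =>
      have e : translationShuffle hA j u (a ⊗ₜ[K] (h ⊗ₜ[K] w)) =
        shuffle i j (hA.canEquiv.symm (a ⊗ₜ[K] h)) (BalTensor.mk _ _ u w) := rfl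
      rw [e, hA.canEquiv_symm_tmul, ← one_mul u, ← extMulLeft_mk, shuffle_extMulLeft, one_mul]
      rfl

/-- The map `(A ⊗ P) ⊗ C → (A ⊗ P) ⊗_{B ⊗ D} (A ⊗ P)` inverting the canonical map of
`A □_H P`. -/
def canInv (hA : IsCoalgebraGalois i ρ.toLinearMap) (hP : IsCoalgebraGalois j ρC)
    (hj : ∀ d, l (j d) = 1 ⊗ₜ[K] j d) :
    (A ⊗[K] P) ⊗[K] C →ₗ[K] ExtTensor (Algebra.TensorProduct.map i j) :=
  tensorTwist hj hA.translation ∘ₗ (LinearEquiv.lTensor A hP.canEquiv).symm.toLinearMap ∘ₗ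
    (TensorProduct.assoc K A P C).toLinearMap

theorem canInv_tmul (hA : IsHopfGalois i ρ) (hP : IsCoalgebraGalois j ρC)
    (hj : ∀ d, l (j d) = 1 ⊗ₜ[K] j d) (q : A ⊗[K] P) (c : C) :
    canInv hA hP hj (q ⊗ₜ[K] c) = canInvFormula hA hP hj q c := by
  rw [canInvFormula]
  induction q using TensorProduct.induction_on with
  | zero =>
    rw [← extMulLeftHom_apply, map_zero, TensorProduct.zero_tmul, map_zero, LinearMap.zero_apply]
  | add x y hx hy => rw [TensorProduct.add_tmul, map_add, hx, hy, extMulLeft_add]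
  | tmul a p =>
    have e : canInv hA hP hj ((a ⊗ₜ[K] p) ⊗ₜ[K] c) = tensorTwist hj
      (IsCoalgebraGalois.translation hA) (a ⊗ₜ[K] hP.canEquiv.symm (p ⊗ₜ[K] c)) := rfl
    rw [e, hP.canEquiv_symm_tmul, tensorTwist_tmul, twist_extMulLeft, ← extMulLeft_mul,
      Algebra.TensorProduct.tmul_mul_tmul, mul_one, one_mul]

/-- The heart of the formula. Inverting the canonical map of `P` leaves the twist applied to `s`;
the cotensor condition on `s` replaces `l` by `ρ`, after which the translation map of `A` cancels
the coaction. Only the second entry has to lie in `A □_H P`. -/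
theorem canInv_mulFst_tensorCoaction (hA : IsCoalgebraGalois i ρ.toLinearMap)
    (hP : IsCoalgebraGalois j ρC) (hj : ∀ d, l (j d) = 1 ⊗ₜ[K] j d) (x : A ⊗[K] P)
    (s : cotensor ρ l) : canInv hA hP hj (mulFst C x (tensorCoaction A ρC (s : A ⊗[K] P))) =
      BalTensor.mk _ _ x (s : A ⊗[K] P) := by
  induction x using TensorProduct.induction_on with
  | zero => rw [← mulFstHom_apply, map_zero, map_zero, LinearMap.zero_apply, LinearMap.zero_apply,
      map_zero]
  | add x y hx hy => rw [map_add, LinearMap.add_apply, mulFst_add, map_add, hx, hy]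
  | tmul a p =>
    have h1 (y : A ⊗[K] P) : BalTensor.tensorLeft (rightAct j) (leftAct j) A
        (BalTensor.mk _ _ p y) = (BalTensor.mk (rightAct j) (leftAct j) p).lTensor A y := by
      induction y using TensorProduct.induction_on with
      | zero => simp
      | add x y hx hy => simp only [map_add, hx, hy]
      | tmul b q => rfl
    have h2 : (LinearEquiv.lTensor A hP.canEquiv).symm
        (TensorProduct.assoc K A P C
          (mulFst C (a ⊗ₜ[K] p) (tensorCoaction A ρC (s : A ⊗[K] P)))) =
        (BalTensor.mk (rightAct j) (leftAct j) p).lTensor A (mulFst P a (s : A ⊗[K] P)) := by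
      rw [LinearEquiv.symm_apply_eq, ← hP.canTensorLeft_mk, ← h1]
      rfl
    have h3 (z : A ⊗[K] ExtTensor j) : tensorTwist hj hA.translation (mulFst _ a z) =
        extMulLeft (Algebra.TensorProduct.map i j) (a ⊗ₜ[K] 1)
          (tensorTwist hj hA.translation z) := by
      induction z using TensorProduct.induction_on with
      | zero => simp
      | add x y hx hy => simp only [map_add, hx, hy]
      | tmul b w =>
        rw [mulFst_tmul, tensorTwist_tmul, tensorTwist_tmul, ← extMulLeft_mul,
          Algebra.TensorProduct.tmul_mul_tmul, mul_one]
    -- The factors `a` and `p` are split off so that the cotensor condition can be applied to `s`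
    -- itself; they recombine as `(a ⊗ 1)(1 ⊗ p)` at the end.
    rw [canInv, LinearMap.comp_apply, LinearMap.comp_apply, LinearEquiv.coe_coe,
      LinearEquiv.coe_coe, h2, lTensor_mulFst, h3, ← translationShuffle_lTensor,
      ← mem_cotensor.1 s.2, translationShuffle_coactFst, extMulLeft_mk,
      Algebra.TensorProduct.tmul_mul_tmul, mul_one, one_mul]

variable [Module.Flat K C]

/-- A one-sided identity suffices: bijectivity of the canonical map is already known, so evaluating
at preimages yields the formula for the inverse. -/
theorem canInv_can (hA : IsCoalgebraGalois i ρ.toLinearMap)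
    (hP : IsCoalgebraGalois j ρC) (hj : ∀ d, l (j d) = 1 ⊗ₜ[K] j d)
    (hb : IsBicomodule l.toLinearMap ρC) (h)
    (z : ExtTensor (cotensorBase ρ l i j hA.range_eq.le hj)) :
    canInv hA hP hj (cotensorTensorIncl ρ l C (can _ (cotensorCoaction ρ l ρC hb) h z)) =
      cotensorExtIncl ρ l i j hA.range_eq.le hj z := by
  induction z using BalTensor.induction_on with
  | zero => simp only [map_zero]
  | add x y hx hy => simp only [map_add, hx, hy]
  | mk s t =>
    rw [can_mk, cotensorTensorIncl_mulFst, cotensorCoaction_spec, canInv_mulFst_tensorCoaction]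
    rfl

end Formula

end CotensorGalois

end

theorem mainTheorem1 {K : Type u} [CommRing K]
    {H : Type u} [Ring H] [HopfAlgebra K H]
    {C : Type u} [AddCommGroup C] [Module K C] [Coalgebra K C] [Module.Flat K C]
    {A B P D : Type u} [Ring A] [Algebra K A] [Ring B] [Algebra K B]
    [Ring P] [Algebra K P] [Ring D] [Algebra K D]
    -- the `H`-Hopf-Galois extension `A` of `B`
    (i : B →ₐ[K] A) (ρA : A →ₐ[K] A ⊗[K] H) (hA : IsHopfGalois i ρA)
    (hAr : IsRightFaithfullyFlat i) (hAl : IsLeftFlat i)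
    -- the `C`-coalgebra Galois extension `P` of `D`
    (j : D →ₐ[K] P) (ρP : P →ₗ[K] P ⊗[K] C) (hP : IsCoalgebraGalois j ρP)
    (hPr : IsRightFaithfullyFlat j) (hPl : IsLeftFlat j)
    -- `P` is a left `H`-comodule algebra and an `(H, C)`-bicomodule, with `D` left coinvariant
    (lP : P →ₐ[K] H ⊗[K] P) (hlP : IsLeftCoaction lP.toLinearMap)
    (hb : IsBicomodule lP.toLinearMap ρP) (hD : ∀ d, lP (j d) = 1 ⊗ₜ[K] j d) :
    ∃ hG : IsCoalgebraGalois (cotensorBase ρA lP i j hA.range_eq.le hD)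
        (cotensorCoaction ρA lP ρP hb),
      IsRightFaithfullyFlat (cotensorBase ρA lP i j hA.range_eq.le hD) ∧
      Function.Injective (cotensorExtIncl ρA lP i j hA.range_eq.le hD) ∧
      ∀ (q : cotensor ρA lP) (c : C),
        cotensorExtIncl ρA lP i j hA.range_eq.le hD (hG.canEquiv.symm (q ⊗ₜ[K] c)) =
          canInvFormula hA hP hD (q : A ⊗[K] P) c := by
  have hG := isCoalgebraGalois_cotensor hA hAr hPr hlP hP hD hb
  refine ⟨hG, isRightFaithfullyFlat_cotensorBase hA hAr hPr hlP hD,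
    cotensorExtIncl_injective hA.range_eq.le hP.range_eq.le hD hb _ hG.bijective.injective,
    fun q c => ?_⟩
  -- The identity for `canInv` is used at `z = can⁻¹(q ⊗ c)`, whose canonical image is `q ⊗ c`.
  rw [← canInv_tmul, ← canInv_can hA hP hD hb hG.range_eq.le]
  have h : can _ (cotensorCoaction ρA lP ρP hb) hG.range_eq.le
      (hG.canEquiv.symm (q ⊗ₜ[K] c)) = q ⊗ₜ[K] c := hG.canEquiv.apply_symm_apply _
  rw [h]
  rfl
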